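/- A finite sequence of positive integers $a_1,\dots,a_s$ is called strongly unimodal of size $n$ if $a_1+\dots+a_s=n$ and $a_1<\dots<a_{k-1}<a_k>a_{k+1}>\dots>a_s$ for some $k\in\{1,\dots,s\}$; its rank is $s-2k+1$, the number of terms after the maximal term minus the number of terms before it. For $m\in\mathbb{Z}$ let $u(m,n)$ denote the number of strongly unimodal sequences of size $n$ and rank $m$. Theorem. For every fixed integer $m\ge 0$ we have, as $n\to\infty$, $$u(m,n)\sim\frac{1}{16\sqrt3\,n}\,e^{\pi\sqrt{2n/3}},$$ $$u(m,n)-u(m+1,n)\sim\frac{\pi(2m+1)}{96\sqrt2\,n^{3/2}}\,e^{\pi\sqrt{2n/3}},$$ $$u(m,n)^2-u(m-1,n)\,u(m+1,n)\sim\frac{\pi}{768\sqrt6\,n^{5/2}}\,e^{2\pi\sqrt{2n/3}}.$$ In particular, for every fixed $m\in\mathbb{Z}$ there is an $N$ (depending on $m$) such that $u(m,n)^2>u(m-1,n)\,u(m+1,n)$ for all $n\ge N$. -/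

import Mathlib

/-- The list `a = (a₀, …, a_{s-1})` satisfies `a₀ < ⋯ < a_{k-1} < a_k > a_{k+1} > ⋯ > a_{s-1}`:
it is strongly unimodal with its (unique) maximal term at the position `k`, counted from `0`. -/
def IsStronglyUnimodalAt (a : List ℕ) (k : ℕ) : Prop :=
  k < a.length ∧ (a.take (k + 1)).Pairwise (· < ·) ∧ (a.drop k).Pairwise (· > ·)

/-- The peak position is unique, so the rank below is well defined. -/
theorem IsStronglyUnimodalAt.unique {a : List ℕ} {k l : ℕ} (hk : IsStronglyUnimodalAt a k)
    (hl : IsStronglyUnimodalAt a l) : k = l := by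
  have key : ∀ {k l : ℕ}, IsStronglyUnimodalAt a k → IsStronglyUnimodalAt a l → ¬ k < l := by
    rintro k l ⟨-, -, hk⟩ ⟨hl, hl', -⟩ h
    rw [List.pairwise_iff_getElem] at hk hl'
    have h1 := hk 0 1 (by simp; omega) (by simp; omega) (by omega)
    have h2 := hl' k (k + 1) (by simp; omega) (by simp; omega) (by omega)
    simp at h1 h2
    omega
  have h1 := key hk hl
  have h2 := key hl hk
  omega

/-- The sequence `a` is strongly unimodal of rank `m`: the number of terms after its maximal term
minus the number of terms before it is `m`. -/
def IsStronglyUnimodalOfRank (a : List ℕ) (m : ℤ) : Prop :=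
  ∃ k, IsStronglyUnimodalAt a k ∧ ((a.length : ℤ) - 1 - k) - k = m

/-- `u(m, n)`: the number of strongly unimodal sequences of positive integers of sum `n` and rank
`m`. (A `Composition n` is a finite sequence of positive integers, its `blocks`, of sum `n`; there
are finitely many.) -/
noncomputable def unimodalCount (m : ℤ) (n : ℕ) : ℕ :=
  Nat.card {c : Composition n // IsStronglyUnimodalOfRank c.blocks m}

/-!
Let `R_m = (q; q)_∞ U_m`, where `U_m(q) = ∑ u(m, n) q ^ n`. A strongly unimodal sequence is a peak
`N + 1` together with two subsets of `{1, …, N}`, so the `q`-binomial theorem and Euler's identity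
turn `U_m + U_{m+1}` into a single sum: `R_m + R_{m+1}` is the partial theta function
`∑ (-1) ^ k q ^ ((k + m + 1) (3 k + m + 2) / 2)`. Hence `R_m` is a twofold alternating sum of
exponentials of quadratic polynomials. At `q = exp (-z)` each difference of the terms gains a factor
`O(√|z|)`, so the Euler transform gives `R_m = 1 / 4 - ℓ_m z + o(z)` as `z → 0` in a cone, and
`R_m - R_{m+1} ~ (2 m + 1) z / 8`.

The circle method, with the modular transformation of the Dedekind eta function near `q = 1` and a
crude bound for `1 / (q; q)_∞` elsewhere on the circle, converts these into `u(m, n) ~ p(n) / 4` and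
`u(m, n) - u(m + 1, n) ~ (2 m + 1) p(n) x / 8`, where `x = π / √(6 n)` is the saddle point. The
third asymptotics needs no further expansion: if `d_m = u(m, n) - u(m + 1, n)`, then
`u(m, n) ^ 2 - u(m - 1, n) u(m + 1, n) = u(m, n) (d_m - d_{m-1}) + d_m d_{m-1}`,
whose first term dominates.
-/

section

open Complex Filter Topology MeasureTheory
open scoped Real fwdDiff

/-! ### The Euler product and its modular transformation -/

/-- The Euler product `(q; q)_∞`, the reciprocal of the generating function of partitions. -/
noncomputable def eulerProd (q : ℂ) : ℂ := ∏' n : ℕ, (1 - q ^ (n + 1))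

lemma norm_exp_neg_lt_one {z : ℂ} (hz : 0 < z.re) : ‖exp (-z)‖ < 1 := by
  simp [norm_exp, hz]

lemma norm_pow_succ_lt_one {q : ℂ} (hq : ‖q‖ < 1) (n : ℕ) : ‖q ^ (n + 1)‖ < 1 :=
  (norm_pow q _).trans_lt (pow_lt_one₀ (norm_nonneg q) hq n.succ_ne_zero)

lemma one_sub_ne_zero_of_norm_lt_one {q : ℂ} (hq : ‖q‖ < 1) : 1 - q ≠ 0 :=
  sub_ne_zero.mpr fun h ↦ by simp [← h] at hq

lemma one_sub_pow_succ_ne_zero {q : ℂ} (hq : ‖q‖ < 1) (n : ℕ) : 1 - q ^ (n + 1) ≠ 0 :=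
  one_sub_ne_zero_of_norm_lt_one (norm_pow_succ_lt_one hq n)

lemma eulerProd_ne_zero {q : ℂ} (hq : ‖q‖ < 1) : eulerProd q ≠ 0 := by
  refine tprod_one_add_ne_zero_of_summable (f := fun n ↦ -q ^ (n + 1)) (fun n ↦ ?_) ?_
  · simpa [← sub_eq_add_neg] using one_sub_pow_succ_ne_zero hq n
  · simpa using (summable_nat_add_iff 1).mpr (summable_geometric_of_lt_one (norm_nonneg _) hq)

lemma hasProd_eulerProd {q : ℂ} (hq : ‖q‖ < 1) :
    HasProd (fun n : ℕ ↦ 1 - q ^ (n + 1)) (eulerProd q) :=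
  (ModularForm.multipliable_one_sub_pow hq).hasProd

lemma continuousOn_eulerProd : ContinuousOn eulerProd (Metric.ball 0 1) :=
  ModularForm.differentiableOn_tprod_one_sub_pow.continuousOn

lemma tendsto_eulerProd_zero : Tendsto eulerProd (𝓝 0) (𝓝 1) := by
  simpa [ContinuousAt, eulerProd] using
    continuousOn_eulerProd.continuousAt (Metric.ball_mem_nhds 0 one_pos)

lemma sqrt_mul_of_arg_add_arg_mem {a b : ℂ} (ha : a ≠ 0) (hb : b ≠ 0)
    (h : arg a + arg b ∈ Set.Ioc (-π) π) : sqrt (a * b) = sqrt a * sqrt b := by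
  rw [sqrt_eq_exp (mul_ne_zero ha hb), sqrt_eq_exp ha, sqrt_eq_exp hb, log_mul ha hb h, ← exp_add]
  ring_nf

lemma sqrt_I_mul {w : ℂ} (hw : 0 < w.re) : sqrt (I * w) = sqrt I * sqrt w := by
  have harg := abs_lt.mp (abs_arg_lt_pi_div_two_iff.mpr (Or.inl hw))
  refine sqrt_mul_of_arg_add_arg_mem I_ne_zero (ne_zero_of_re_pos hw) ?_
  rw [arg_I]
  constructor <;> linarith [Real.pi_pos]

lemma sqrt_ofReal_mul {r : ℝ} (hr : 0 < r) {w : ℂ} (hw : w ≠ 0) :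
    sqrt (r * w) = √r * sqrt w := by
  rw [sqrt_mul_of_arg_add_arg_mem (ofReal_ne_zero.mpr hr.ne') hw, sqrt_of_nonneg]
  · simp
  · exact_mod_cast hr.le
  · simpa [arg_ofReal_of_nonneg hr.le] using arg_mem_Ioc w

lemma eta_eq_exp_mul_eulerProd (w : ℂ) :
    ModularForm.eta (I * w / (2 * π)) = exp (-w / 24) * eulerProd (exp (-w)) := by
  have h : 2 * π * I * (I * w / (2 * π)) = -w := by
    field_simp
    rw [I_sq, neg_one_mul]
  simp only [ModularForm.eta, eulerProd, ModularForm.eta_q, Function.Periodic.qParam, h,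
    ofReal_one, div_one, ofReal_ofNat]

lemma eta_I_mul_four_pi_sq_div {z : ℂ} (hz : 0 < z.re) :
    ModularForm.eta (I * (4 * π ^ 2 / z) / (2 * π)) =
      sqrt (z / (2 * π)) * ModularForm.eta (I * z / (2 * π)) := by
  have hz0 := ne_zero_of_re_pos hz
  have hre : 0 < (z / (2 * π)).re := by
    rw [← ofReal_ofNat, ← ofReal_mul, div_ofReal_re]
    positivity
  have hdual : -1 / (I * z / (2 * π)) = I * (4 * π ^ 2 / z) / (2 * π) := by
    field_simp
    rw [I_sq]
    ring
  have hsqrt : sqrt (I * z / (2 * π)) = sqrt I * sqrt (z / (2 * π)) := by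
    rw [mul_div_assoc, sqrt_I_mul hre]
  have hI : sqrt I ≠ 0 := by simp [Complex.sqrt]
  have key := ModularForm.eta_comp_eq_csqrt_I_inv (x := I * z / (2 * π))
    (by simpa [mul_div_assoc, UpperHalfPlane.upperHalfPlaneSet] using hre)
  simpa [hdual, hsqrt, hI, ← mul_assoc] using key

lemma re_four_pi_sq_div (z : ℂ) : (4 * π ^ 2 / z : ℂ).re = 4 * π ^ 2 * z.re / normSq z := by
  rw [div_re]
  norm_cast
  simp

lemma re_four_pi_sq_div_pos {z : ℂ} (hz : 0 < z.re) : 0 < (4 * π ^ 2 / z : ℂ).re := by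
  rw [re_four_pi_sq_div]
  have := normSq_pos.mpr (ne_zero_of_re_pos hz)
  positivity

lemma inv_eulerProd_exp_neg {z : ℂ} (hz : 0 < z.re) :
    (eulerProd (exp (-z)))⁻¹ = sqrt (z / (2 * π)) * exp (π ^ 2 / (6 * z)) *
      (exp (-z / 24) / eulerProd (exp (-(4 * π ^ 2 / z)))) := by
  have hz0 := ne_zero_of_re_pos hz
  have key := eta_I_mul_four_pi_sq_div hz
  have hexp : exp (-(4 * π ^ 2 / z) / 24) = (exp (π ^ 2 / (6 * z)))⁻¹ := by
    rw [← exp_neg]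
    congr 1
    field_simp
    ring
  rw [eta_eq_exp_mul_eulerProd, eta_eq_exp_mul_eulerProd, hexp] at key
  have h₁ := eulerProd_ne_zero (norm_exp_neg_lt_one hz)
  have h₂ := eulerProd_ne_zero (norm_exp_neg_lt_one (re_four_pi_sq_div_pos hz))
  have h₃ := exp_ne_zero (π ^ 2 / (6 * z))
  rw [inv_mul_eq_iff_eq_mul₀ h₃] at key
  rw [mul_div_assoc', eq_div_iff h₂, key, inv_mul_eq_iff_eq_mul₀ h₁]
  ring

/-- The filter of approach to `0` inside the cone `|im z| ≤ re z`. -/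
noncomputable def coneFilter : Filter ℂ := 𝓝[{z : ℂ | 0 < z.re ∧ |z.im| ≤ z.re}] 0

lemma eventually_coneFilter_mem : ∀ᶠ z in coneFilter, 0 < z.re ∧ |z.im| ≤ z.re :=
  eventually_mem_nhdsWithin

lemma tendsto_id_coneFilter : Tendsto (fun z : ℂ ↦ z) coneFilter (𝓝 0) := nhdsWithin_le_nhds

lemma tendsto_re_coneFilter : Tendsto re coneFilter (𝓝[>] 0) :=
  tendsto_nhdsWithin_iff.mpr ⟨(continuous_re.tendsto' 0 0 zero_re).comp tendsto_id_coneFilter,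
    eventually_coneFilter_mem.mono fun _ hz ↦ hz.1⟩

lemma norm_le_two_mul_re {z : ℂ} (hz : |z.im| ≤ z.re) : ‖z‖ ≤ 2 * z.re := by
  calc ‖z‖ ≤ |z.re| + |z.im| := norm_le_abs_re_add_abs_im z
    _ ≤ z.re + z.re := by
      gcongr
      exact (abs_of_nonneg ((abs_nonneg _).trans hz)).le
    _ = 2 * z.re := (two_mul _).symm

lemma inv_re_le_re_four_pi_sq_div {z : ℂ} (hz : 0 < z.re) (hz' : |z.im| ≤ z.re) :
    z.re⁻¹ ≤ (4 * π ^ 2 / z : ℂ).re := by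
  have hnorm : normSq z ≤ 4 * z.re ^ 2 := by
    rw [normSq_eq_norm_sq, show 4 * z.re ^ 2 = (2 * z.re) ^ 2 by ring]
    gcongr
    exact norm_le_two_mul_re hz'
  rw [re_four_pi_sq_div, le_div_iff₀ (normSq_pos.mpr (ne_zero_of_re_pos hz)),
    inv_mul_le_iff₀ hz]
  calc normSq z ≤ 4 * 1 ^ 2 * z.re ^ 2 := by linarith
    _ ≤ 4 * π ^ 2 * z.re ^ 2 := by
      gcongr
      linarith [Real.pi_gt_three]
    _ = z.re * (4 * π ^ 2 * z.re) := by ring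

lemma tendsto_exp_div_eulerProd_dual :
    Tendsto (fun z : ℂ ↦ exp (-z / 24) / eulerProd (exp (-(4 * π ^ 2 / z)))) coneFilter (𝓝 1) := by
  have hnum : Tendsto (fun z : ℂ ↦ exp (-z / 24)) coneFilter (𝓝 1) :=
    (Continuous.tendsto' (by fun_prop) 0 1 (by simp)).mono_left nhdsWithin_le_nhds
  have hq : Tendsto (fun z : ℂ ↦ exp (-(4 * π ^ 2 / z))) coneFilter (𝓝 0) := by
    refine squeeze_zero_norm' ?_ (Real.tendsto_exp_neg_atTop_nhds_zero.comp
      (tendsto_inv_nhdsGT_zero.comp tendsto_re_coneFilter))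
    filter_upwards [eventually_coneFilter_mem] with z ⟨hz, hz'⟩
    rw [norm_exp, neg_re]
    exact Real.exp_le_exp.mpr (neg_le_neg (inv_re_le_re_four_pi_sq_div hz hz'))
  simpa [Function.comp_def, Pi.div_def] using hnum.div (tendsto_eulerProd_zero.comp hq) one_ne_zero

-- Compare the series of `-log (1 - w)` and `-log (1 - ‖w‖)` from their second terms on.
lemma one_sub_norm_mul_exp_le {w : ℂ} (hw : ‖w‖ < 1) :
    (1 - ‖w‖) * Real.exp ‖w‖ ≤ ‖1 - w‖ * Real.exp w.re := by
  have h₁ : HasSum (fun n : ℕ ↦ (w ^ (n + 2) / (n + 2 : ℕ)).re) (-Real.log ‖1 - w‖ - w.re) := by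
    simpa [Finset.sum_range_succ, log_re] using
      (hasSum_nat_add_iff' 2).mpr (hasSum_re (hasSum_taylorSeries_neg_log hw))
  have h₂ : HasSum (fun n : ℕ ↦ ‖w‖ ^ (n + 2) / (n + 2 : ℕ)) (-Real.log (1 - ‖w‖) - ‖w‖) := by
    simpa [add_assoc, one_add_one_eq_two] using (hasSum_nat_add_iff' 1).mpr
      (Real.hasSum_pow_div_log_of_abs_lt_one (by simpa using hw))
  have hle := hasSum_le (fun n ↦ (re_le_norm _).trans_eq (by simp [-Nat.cast_add])) h₁ h₂
  rw [← Real.exp_log (sub_pos.mpr hw), ← Real.exp_add,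
    ← Real.exp_log (norm_pos_iff.mpr (one_sub_ne_zero_of_norm_lt_one hw)), ← Real.exp_add,
    Real.exp_le_exp]
  linarith

lemma norm_eulerProd_norm_mul_exp_le {q : ℂ} (hq : ‖q‖ < 1) :
    ‖eulerProd (‖q‖ : ℂ)‖ * Real.exp (‖q‖ / (1 - ‖q‖)) ≤
      ‖eulerProd q‖ * Real.exp (q / (1 - q)).re := by
  have hgeo : HasSum (fun n : ℕ ↦ (q ^ (n + 1)).re) (q / (1 - q)).re := by
    simpa [pow_succ', div_eq_mul_inv] using
      hasSum_re ((hasSum_geometric_of_norm_lt_one hq).mul_left q)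
  have hgeo' : HasSum (fun n : ℕ ↦ ‖q‖ ^ (n + 1)) (‖q‖ / (1 - ‖q‖)) := by
    simpa [pow_succ', div_eq_mul_inv] using
      (hasSum_geometric_of_lt_one (norm_nonneg _) hq).mul_left ‖q‖
  have hexp {f : ℕ → ℝ} {s : ℝ} (hf : HasSum f s) := (Real.continuous_exp.tendsto s).comp
    hf.tendsto_sum_nat
  refine le_of_tendsto_of_tendsto'
    ((hasProd_eulerProd (q := ‖q‖) (by simpa)).tendsto_prod_nat.norm.mul (hexp hgeo'))
    ((hasProd_eulerProd hq).tendsto_prod_nat.norm.mul (hexp hgeo)) fun N ↦ ?_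
  simp only [Function.comp, Real.exp_sum, norm_prod, ← Finset.prod_mul_distrib]
  refine Finset.prod_le_prod (fun _ _ ↦ by positivity) fun n _ ↦ ?_
  have hqn := norm_pow_succ_lt_one hq n
  have hnorm : ‖1 - (‖q‖ : ℂ) ^ (n + 1)‖ = 1 - ‖q ^ (n + 1)‖ := by
    rw [← ofReal_pow, ← norm_pow, ← ofReal_one, ← ofReal_sub, norm_real,
      Real.norm_of_nonneg (sub_pos.mpr hqn).le]
  rw [hnorm, ← norm_pow]
  exact one_sub_norm_mul_exp_le hqn

lemma norm_inv_eulerProd_le {q : ℂ} (hq : ‖q‖ < 1) :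
    ‖(eulerProd q)⁻¹‖ ≤ ‖(eulerProd (‖q‖ : ℂ))⁻¹‖ *
      Real.exp ((q / (1 - q)).re - ‖q‖ / (1 - ‖q‖)) := by
  have h₁ := norm_pos_iff.mpr (eulerProd_ne_zero hq)
  have h₂ := norm_pos_iff.mpr (eulerProd_ne_zero (q := ‖q‖) (by simpa))
  rw [norm_inv, norm_inv, Real.exp_sub, inv_mul_eq_div, le_div_iff₀ h₂, inv_mul_le_iff₀ h₁,
    mul_div_assoc', le_div_iff₀ (Real.exp_pos _)]
  exact norm_eulerProd_norm_mul_exp_le hq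

/-! ### Finite differences and the Euler transform -/

lemma norm_fwdDiff_iter_le {E : Type*} [NormedAddCommGroup E] [NormedSpace ℂ E] {f : ℂ → E}
    (hf : Differentiable ℂ f) {s : ℂ} {ρ B : ℝ} (hρ : 0 < ρ) (r : ℕ)
    (hB : ∀ w ∈ Metric.closedBall s (r * (ρ + 1)), ‖f w‖ ≤ B) : ‖(Δ_[1])^[r] f s‖ ≤ B / ρ ^ r := by
  induction r generalizing f B with
  | zero => simpa using hB s (by simp)
  | succ r ih =>
    rw [Function.iterate_succ_apply, pow_succ', ← div_div]
    refine ih (by unfold fwdDiff; fun_prop) fun w hw ↦ ?_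
    have hball : Metric.closedBall w (ρ + 1) ⊆ Metric.closedBall s ((r + 1 : ℕ) * (ρ + 1)) := by
      refine Metric.closedBall_subset_closedBall' ?_
      rw [Metric.mem_closedBall] at hw
      push_cast
      linarith
    have hderiv : ∀ x ∈ Metric.closedBall w 1, ‖deriv f x‖ ≤ B / ρ := fun x hx ↦
      norm_deriv_le_of_forall_mem_sphere_norm_le hρ hf.diffContOnCl fun y hy ↦
        hB y (hball (Metric.closedBall_subset_closedBall' (by
          rw [Metric.mem_closedBall] at hx
          linarith) (Metric.sphere_subset_closedBall hy)))
    simpa [fwdDiff] using (convex_closedBall w 1).norm_image_sub_le_of_norm_deriv_le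
      (fun x _ ↦ hf x) hderiv (x := w) (y := w + 1) (by simp) (by simp)

lemma fwdDiff_iter_comp_natCast {R G : Type*} [AddCommMonoidWithOne R] [AddCommGroup G]
    (f : R → G) (c : R) (r j : ℕ) :
    (Δ_[1])^[r] (fun j : ℕ ↦ f (c + j)) j = (Δ_[1])^[r] f (c + j) := by
  simp [fwdDiff_iter_eq_sum_shift, add_assoc]

lemma fwdDiff_iter_tsum {ι M G : Type*} [AddCommMonoid M] [NormedAddCommGroup G] {f : ι → M → G}
    (hf : ∀ y, Summable fun i ↦ f i y) (h : M) (r : ℕ) (y : M) :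
    (Δ_[h])^[r] (fun y ↦ ∑' i, f i y) y = ∑' i, (Δ_[h])^[r] (f i) y := by
  simp only [fwdDiff_iter_eq_sum_shift]
  rw [Summable.tsum_finsetSum fun i _ ↦ (hf _).const_smul _]
  exact Finset.sum_congr rfl fun i _ ↦ ((hf _).tsum_const_smul _).symm

section EulerTransform

variable {E : Type*} [NormedAddCommGroup E]

lemma tendsto_fwdDiff_iter_zero {S : ℕ → E} (hS : Tendsto S atTop (𝓝 0)) (r : ℕ) :
    Tendsto ((Δ_[1])^[r] S) atTop (𝓝 0) := by
  induction r generalizing S with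
  | zero => simpa
  | succ r ih =>
    rw [Function.iterate_succ_apply]
    refine ih ?_
    simpa [fwdDiff] using! ((tendsto_add_atTop_iff_nat 1).mpr hS).sub hS

lemma fwdDiff_iter_add_succ {G : Type*} [AddCommGroup G] {S b : ℕ → G}
    (h : ∀ k, S k + S (k + 1) = b k) (r k : ℕ) :
    (Δ_[1])^[r] S k + (Δ_[1])^[r] S (k + 1) = (Δ_[1])^[r] b k := by
  rw [show b = S + fun k ↦ S (k + 1) from funext fun k ↦ (h k).symm, fwdDiff_iter_add,
    Pi.add_apply, fwdDiff_iter_comp_add]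

lemma norm_le_tsum_of_add_succ {S b : ℕ → E} (h : ∀ k, S k + S (k + 1) = b k)
    (hS : Tendsto S atTop (𝓝 0)) (hb : Summable fun k ↦ ‖b k‖) : ‖S 0‖ ≤ ∑' k, ‖b k‖ := by
  have hpartial (n : ℕ) : ‖S 0‖ ≤ ∑ k ∈ Finset.range n, ‖b k‖ + ‖S n‖ := by
    induction n with
    | zero => simp
    | succ n ih =>
      have : ‖S n‖ ≤ ‖b n‖ + ‖S (n + 1)‖ := by
        simpa [← h n] using norm_sub_le (S n + S (n + 1)) (S (n + 1))
      rw [Finset.sum_range_succ]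
      linarith
  have hlim := hb.hasSum.tendsto_sum_nat.add hS.norm
  rw [norm_zero, add_zero] at hlim
  exact ge_of_tendsto' hlim hpartial

variable [NormedSpace ℝ E]

/-- The Euler transform, truncated at order `r`, of the alternating series `∑ (-1) ^ k • b k`. It is
the formal solution of `S k + S (k + 1) = b k`, i.e. of `(2 + Δ) S = b`, up to order `r` in `Δ`. -/
noncomputable def eulerTransform (r : ℕ) (b : ℕ → E) : E :=
  ∑ i ∈ Finset.range r, ((-1 / 2) ^ i / 2 : ℝ) • (Δ_[1])^[i] b 0

lemma eulerTransform_const {r : ℕ} (hr : r ≠ 0) (c : E) :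
    eulerTransform r (fun _ ↦ c) = (1 / 2 : ℝ) • c := by
  obtain ⟨r, rfl⟩ := Nat.exists_eq_succ_of_ne_zero hr
  have h0 (i : ℕ) : (Δ_[1])^[i] (fun _ : ℕ ↦ (0 : E)) 0 = 0 := by simp [fwdDiff_iter_eq_sum_shift]
  simp [eulerTransform, Finset.sum_range_succ', h0]

lemma eulerTransform_sub (r : ℕ) (b c : ℕ → E) :
    eulerTransform r (fun k ↦ b k - c k) = eulerTransform r b - eulerTransform r c := by
  simp [eulerTransform, fwdDiff_iter_eq_sum_shift, smul_sub, Finset.sum_sub_distrib]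

lemma eulerTransform_const_mul {A : Type*} [NormedRing A] [NormedAlgebra ℝ A] (r : ℕ) (a : A)
    (b : ℕ → A) : eulerTransform r (fun k ↦ a * b k) = a * eulerTransform r b := by
  simp only [eulerTransform, fwdDiff_iter_eq_sum_shift, Finset.mul_sum, mul_smul_comm]

lemma isLittleO_eulerTransform {α F : Type*} [NormedAddCommGroup F] {l : Filter α}
    {f : α → ℕ → E} {g : α → F} (hf : ∀ k, (f · k) =o[l] g) (r : ℕ) :
    (fun x ↦ eulerTransform r (f x)) =o[l] g := by
  simp only [eulerTransform, fwdDiff_iter_eq_sum_shift, ← Int.cast_smul_eq_zsmul ℝ]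
  exact .fun_sum fun i _ ↦
    .const_smul_left (.fun_sum fun j _ ↦ .const_smul_left (hf _) (_ : ℝ)) (_ : ℝ)

lemma sub_eulerTransform_eq_smul_fwdDiff_iter {S b : ℕ → E} (h : ∀ k, S k + S (k + 1) = b k)
    (r : ℕ) : S 0 - eulerTransform r b = (-1 / 2 : ℝ) ^ r • (Δ_[1])^[r] S 0 := by
  induction r with
  | zero => simp [eulerTransform]
  | succ r ih =>
    have hb : (Δ_[1])^[r] b 0 = (2 : ℝ) • (Δ_[1])^[r] S 0 + (Δ_[1])^[r + 1] S 0 := by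
      rw [← fwdDiff_iter_add_succ h, Function.iterate_succ_apply', fwdDiff, two_smul]
      abel
    rw [eulerTransform, Finset.sum_range_succ, ← sub_sub, ← eulerTransform, ih, hb, pow_succ]
    module

lemma norm_sub_eulerTransform_le {S b : ℕ → E} (h : ∀ k, S k + S (k + 1) = b k)
    (hS : Tendsto S atTop (𝓝 0)) (r : ℕ) (hb : Summable fun k ↦ ‖(Δ_[1])^[r] b k‖) :
    ‖S 0 - eulerTransform r b‖ ≤ ∑' k, ‖(Δ_[1])^[r] b k‖ := by
  rw [sub_eulerTransform_eq_smul_fwdDiff_iter h, norm_smul]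
  refine (mul_le_of_le_one_left (norm_nonneg _) ?_).trans <|
    norm_le_tsum_of_add_succ (fwdDiff_iter_add_succ h r) (tendsto_fwdDiff_iter_zero hS r) hb
  rw [norm_pow]
  exact pow_le_one₀ (norm_nonneg _) (by norm_num)

lemma norm_alternating_tsum_sub_eulerTransform_le [CompleteSpace E] {a : ℕ → E}
    (ha : Summable fun k ↦ ‖a k‖) (r : ℕ) (hr : Summable fun k ↦ ‖(Δ_[1])^[r] a k‖) :
    ‖∑' k, (-1 : ℝ) ^ k • a k - eulerTransform r a‖ ≤ ∑' k, ‖(Δ_[1])^[r] a k‖ := by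
  have hs (n : ℕ) : Summable fun i ↦ ‖(-1 : ℝ) ^ i • a (i + n)‖ := by
    simpa [norm_smul] using (summable_nat_add_iff n).mpr ha
  refine norm_sub_eulerTransform_le (S := fun n ↦ ∑' i, (-1 : ℝ) ^ i • a (i + n))
    (fun k ↦ ?_) ?_ r hr
  · rw [(hs k).of_norm.tsum_eq_zero_add]
    simp [pow_succ, add_assoc, add_comm 1 k, tsum_neg]
  · refine squeeze_zero_norm (fun n ↦ norm_tsum_le_tsum_norm (hs n)) ?_
    simpa [norm_smul] using tendsto_sum_nat_add fun k ↦ ‖a k‖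

end EulerTransform

/-! ### Partial theta functions near `q = 1` -/

/-- The quadratic exponent of `q` in the partial theta functions. -/
noncomputable def thetaExponent (s t : ℂ) : ℂ := (t + s) * (3 * t + s + 1) / 2

/-- The general term `q ^ thetaExponent s t` of the partial theta functions, at `q = exp (-z)`. -/
noncomputable def thetaTerm (z s t : ℂ) : ℂ := exp (-z * thetaExponent s t)

/-- The partial theta function `∑ (-1) ^ k q ^ ((k + μ) (3 k + μ + 1) / 2)` at `q = exp (-z)`. -/
noncomputable def partialTheta (z : ℂ) (μ : ℕ) : ℂ := ∑' k : ℕ, (-1 : ℝ) ^ k • thetaTerm z μ k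

lemma norm_thetaExponent_add_sub_le {s t ρ : ℝ} (hs : 0 ≤ s) (ht : 0 ≤ t) {v w : ℂ}
    (hv : ‖v‖ ≤ ρ) (hw : ‖w‖ ≤ ρ) :
    ‖thetaExponent (s + v) (t + w) - thetaExponent s t‖ ≤
      ρ * (5 * t + 3 * s + 1) + 4 * ρ ^ 2 := by
  have hρ : 0 ≤ ρ := (norm_nonneg v).trans hv
  have hsplit : thetaExponent (s + v) (t + w) - thetaExponent s t =
      ((t + s : ℝ) * (3 * w + v) + (w + v) * (3 * t + s + 1 : ℝ) + (w + v) * (3 * w + v)) / 2 := by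
    simp only [thetaExponent]
    push_cast
    ring
  have h₁ : ‖w + v‖ ≤ 2 * ρ := (norm_add_le _ _).trans (by linarith)
  have h₂ : ‖3 * w + v‖ ≤ 4 * ρ := (norm_add_le _ _).trans (by rw [norm_mul, norm_ofNat]; linarith)
  rw [hsplit, norm_div, norm_ofNat]
  calc _ ≤ ((t + s) * (4 * ρ) + 2 * ρ * (3 * t + s + 1) + 2 * ρ * (4 * ρ)) / 2 := by
        gcongr
        refine norm_add₃_le.trans ?_
        rw [norm_mul, norm_mul, norm_mul, norm_real, norm_real, Real.norm_of_nonneg (by positivity),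
          Real.norm_of_nonneg (by positivity)]
        gcongr
    _ = _ := by ring

lemma norm_thetaTerm_add_le {z : ℂ} {σ : ℝ} (hσ : 0 < σ) (hσ1 : σ ≤ 1) (hre : z.re = σ ^ 2)
    (him : |z.im| ≤ z.re) {s t : ℝ} (hs : 0 ≤ s) (ht : 0 ≤ t) {v w : ℂ} (hv : ‖v‖ ≤ σ⁻¹)
    (hw : ‖w‖ ≤ σ⁻¹) :
    ‖thetaTerm z (s + v) (t + w)‖ ≤ Real.exp 71 * Real.exp (-(σ * (s + t))) := by
  set D := thetaExponent (s + v) (t + w) - thetaExponent s t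
  have hreal : thetaExponent s t = ((t + s) * (3 * t + s + 1) / 2 : ℝ) := by simp [thetaExponent]
  have hsplit : -z * thetaExponent (s + v) (t + w) = -(z * thetaExponent s t) + -(z * D) := by
    simp only [D]
    ring
  have hD : ‖z * D‖ ≤ 2 * σ * (5 * t + 3 * s + 1) + 8 :=
    calc ‖z * D‖ ≤ 2 * σ ^ 2 * (σ⁻¹ * (5 * t + 3 * s + 1) + 4 * σ⁻¹ ^ 2) := by
          rw [norm_mul]
          gcongr
          · exact hre ▸ norm_le_two_mul_re him
          · exact norm_thetaExponent_add_sub_le hs ht hv hw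
      _ = _ := by field_simp; ring
  have hDre : -(z * D).re ≤ 2 * σ * (5 * t + 3 * s + 1) + 8 :=
    (neg_le_abs _).trans ((abs_re_le_norm _).trans hD)
  have hmain : σ ^ 2 * (s + t) ^ 2 / 2 ≤ σ ^ 2 * ((t + s) * (3 * t + s + 1) / 2) := by
    rw [mul_div_assoc]
    gcongr
    nlinarith
  rw [thetaTerm, norm_exp, ← Real.exp_add, Real.exp_le_exp, hsplit, add_re, neg_re, neg_re, hreal,
    re_mul_ofReal, hre]
  -- With `u = σ (s + t)` the exponent is at most `-u ^ 2 / 2 + 10 u + 10 ≤ -u + 71`.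
  nlinarith [sq_nonneg (σ * (s + t) - 11), mul_nonneg hσ.le hs]

lemma hasSum_exp_neg_mul {σ : ℝ} (hσ : 0 < σ) :
    HasSum (fun k : ℕ ↦ Real.exp (-(σ * k))) (1 - Real.exp (-σ))⁻¹ := by
  convert hasSum_geometric_of_lt_one (Real.exp_pos (-σ)).le (by simpa using hσ) using 2 with k
  rw [← Real.exp_nat_mul, mul_neg, mul_comm]

lemma inv_one_sub_exp_neg_le {σ : ℝ} (hσ : 0 < σ) (hσ1 : σ ≤ 1) :
    (1 - Real.exp (-σ))⁻¹ ≤ 2 / σ := by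
  have hexp : Real.exp (-σ) ≤ 1 - σ / 2 := by
    rw [Real.exp_neg, inv_le_comm₀ (Real.exp_pos _) (by linarith)]
    refine le_trans ?_ (Real.add_one_le_exp σ)
    rw [inv_le_iff_one_le_mul₀ (by linarith)]
    nlinarith
  rw [inv_le_comm₀ (by linarith) (by positivity), inv_div]
  linarith

lemma tsum_le_of_le_exp_neg_mul {f : ℕ → ℝ} {σ B : ℝ} (hσ : 0 < σ) (hσ1 : σ ≤ 1)
    (hf : ∀ k, 0 ≤ f k) (hfB : ∀ k, f k ≤ B * Real.exp (-(σ * k))) :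
    Summable f ∧ ∑' k, f k ≤ B * (2 / σ) := by
  have hgeo := (hasSum_exp_neg_mul hσ).mul_left B
  have hB : 0 ≤ B := by simpa using (hf 0).trans (hfB 0)
  have hsum := Summable.of_nonneg_of_le hf hfB hgeo.summable
  refine ⟨hsum, (hsum.tsum_le_tsum hfB hgeo.summable).trans ?_⟩
  rw [hgeo.tsum_eq]
  exact mul_le_mul_of_nonneg_left (inv_one_sub_exp_neg_le hσ hσ1) hB

section SmallParameter

variable {z : ℂ} {σ : ℝ} {r : ℕ}

lemma norm_fwdDiff_iter_le_of_closedBall {f : ℂ → ℂ} (hf : Differentiable ℂ f) (hσ : 0 < σ)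
    (hσ1 : σ ≤ 1 / 10) (hr : r ≤ 5) {s : ℂ} {B : ℝ}
    (hB : ∀ w ∈ Metric.closedBall s σ⁻¹, ‖f w‖ ≤ B) :
    ‖(Δ_[1])^[r] f s‖ ≤ B * (10 * σ) ^ r := by
  have hradius : r * (σ⁻¹ / 10 + 1) ≤ σ⁻¹ := by
    have h10 : 10 ≤ σ⁻¹ := by
      rw [le_inv_comm₀ (by norm_num) hσ]
      linarith
    have : (r : ℝ) ≤ 5 := by exact_mod_cast hr
    nlinarith
  convert norm_fwdDiff_iter_le hf (by positivity : 0 < σ⁻¹ / 10) r fun w hw ↦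
    hB w (Metric.closedBall_subset_closedBall hradius hw) using 1
  rw [inv_eq_one_div, div_div, one_div, inv_pow, div_inv_eq_mul, mul_comm σ]

lemma norm_fwdDiff_thetaTerm_right_le (hσ : 0 < σ) (hσ1 : σ ≤ 1 / 10) (hre : z.re = σ ^ 2)
    (him : |z.im| ≤ z.re) (hr : r ≤ 5) (s t : ℕ) :
    ‖(Δ_[1])^[r] (fun k : ℕ ↦ thetaTerm z s k) t‖ ≤
      Real.exp 71 * (10 * σ) ^ r * Real.exp (-(σ * (s + t))) := by
  have hshift := fwdDiff_iter_comp_natCast (thetaTerm z s) 0 r t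
  simp only [zero_add] at hshift
  rw [hshift, mul_right_comm]
  refine norm_fwdDiff_iter_le_of_closedBall (by unfold thetaTerm thetaExponent; fun_prop) hσ hσ1 hr
    fun w hw ↦ ?_
  simpa using norm_thetaTerm_add_le hσ (by linarith) hre him s.cast_nonneg t.cast_nonneg
    (v := 0) (w := w - t) (by simpa using hσ.le) (mem_closedBall_iff_norm.mp hw)

lemma norm_fwdDiff_thetaTerm_left_le (hσ : 0 < σ) (hσ1 : σ ≤ 1 / 10) (hre : z.re = σ ^ 2)
    (him : |z.im| ≤ z.re) (hr : r ≤ 5) (μ s t : ℕ) :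
    ‖(Δ_[1])^[r] (fun j : ℕ ↦ thetaTerm z (μ + j) t) s‖ ≤
      Real.exp 71 * (10 * σ) ^ r * Real.exp (-(σ * (μ + s + t))) := by
  rw [fwdDiff_iter_comp_natCast (fun w ↦ thetaTerm z w t), mul_right_comm]
  refine norm_fwdDiff_iter_le_of_closedBall (by unfold thetaTerm thetaExponent; fun_prop) hσ hσ1 hr
    fun w hw ↦ ?_
  simpa using norm_thetaTerm_add_le hσ (by linarith) hre him (s := μ + s) (by positivity)
    t.cast_nonneg (v := w - (μ + s)) (w := 0) (mem_closedBall_iff_norm.mp hw)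
    (by simpa using hσ.le)

lemma summable_and_tsum_norm_fwdDiff_thetaTerm_le (hσ : 0 < σ) (hσ1 : σ ≤ 1 / 10)
    (hre : z.re = σ ^ 2) (him : |z.im| ≤ z.re) (hr : r ≤ 5) (s : ℕ) :
    (Summable fun k ↦ ‖(Δ_[1])^[r] (fun k : ℕ ↦ thetaTerm z s k) k‖) ∧
      ∑' k, ‖(Δ_[1])^[r] (fun k : ℕ ↦ thetaTerm z s k) k‖ ≤
        Real.exp 71 * (10 * σ) ^ r * (2 / σ) := by
  refine tsum_le_of_le_exp_neg_mul hσ (by linarith) (fun _ ↦ norm_nonneg _) fun k ↦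
    (norm_fwdDiff_thetaTerm_right_le hσ hσ1 hre him hr s k).trans ?_
  gcongr
  exact le_add_of_nonneg_left s.cast_nonneg

lemma summable_norm_thetaTerm (hσ : 0 < σ) (hσ1 : σ ≤ 1 / 10) (hre : z.re = σ ^ 2)
    (him : |z.im| ≤ z.re) (s : ℕ) : Summable fun k : ℕ ↦ ‖thetaTerm z s k‖ :=
  (summable_and_tsum_norm_fwdDiff_thetaTerm_le (r := 0) hσ hσ1 hre him (by norm_num) s).1

lemma norm_partialTheta_sub_eulerTransform_le (hσ : 0 < σ) (hσ1 : σ ≤ 1 / 10)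
    (hre : z.re = σ ^ 2) (him : |z.im| ≤ z.re) (hr : r ≤ 5) (μ : ℕ) :
    ‖partialTheta z μ - eulerTransform r fun k : ℕ ↦ thetaTerm z μ k‖ ≤
      Real.exp 71 * (10 * σ) ^ r * (2 / σ) := by
  obtain ⟨hsum, hle⟩ := summable_and_tsum_norm_fwdDiff_thetaTerm_le hσ hσ1 hre him hr μ
  exact (norm_alternating_tsum_sub_eulerTransform_le
    (summable_norm_thetaTerm hσ hσ1 hre him μ) r hsum).trans hle

lemma norm_fwdDiff_alternating_thetaTerm_le (hσ : 0 < σ) (hσ1 : σ ≤ 1 / 10) (hre : z.re = σ ^ 2)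
    (him : |z.im| ≤ z.re) (hr : r ≤ 5) (μ j k : ℕ) :
    ‖(Δ_[1])^[r] (fun j ↦ (-1 : ℝ) ^ k • thetaTerm z (μ + j : ℕ) k) j‖ ≤
      Real.exp 71 * (10 * σ) ^ r * Real.exp (-(σ * j)) * Real.exp (-(σ * k)) := by
  have hsmul : (fun j : ℕ ↦ (-1 : ℝ) ^ k • thetaTerm z (μ + j : ℕ) k) =
      (-1 : ℝ) ^ k • fun j : ℕ ↦ thetaTerm z (μ + j) k := by
    ext
    simp
  rw [hsmul, fwdDiff_iter_const_smul, Pi.smul_apply, norm_smul, norm_pow, norm_neg, norm_one,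
    one_pow, one_mul, mul_assoc _ (Real.exp _) (Real.exp _), ← Real.exp_add, ← neg_add, ← mul_add]
  refine (norm_fwdDiff_thetaTerm_left_le hσ hσ1 hre him hr μ j k).trans ?_
  gcongr
  exact le_add_of_nonneg_left μ.cast_nonneg

lemma norm_fwdDiff_partialTheta_le (hσ : 0 < σ) (hσ1 : σ ≤ 1 / 10) (hre : z.re = σ ^ 2)
    (him : |z.im| ≤ z.re) (hr : r ≤ 5) (μ j : ℕ) :
    ‖(Δ_[1])^[r] (fun j ↦ partialTheta z (μ + j)) j‖ ≤
      Real.exp 71 * (10 * σ) ^ r * (2 / σ) * Real.exp (-(σ * j)) := by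
  have hsummable (j : ℕ) : Summable fun k : ℕ ↦ (-1 : ℝ) ^ k • thetaTerm z (μ + j : ℕ) k :=
    Summable.of_norm <| by simpa [norm_smul] using summable_norm_thetaTerm hσ hσ1 hre him (μ + j)
  have htsum := fwdDiff_iter_tsum
    (f := fun k j : ℕ ↦ (-1 : ℝ) ^ k • thetaTerm z (μ + j : ℕ) k) hsummable 1 r j
  obtain ⟨hsum, hle⟩ := tsum_le_of_le_exp_neg_mul hσ (by linarith) (fun _ ↦ norm_nonneg _)
    (norm_fwdDiff_alternating_thetaTerm_le hσ hσ1 hre him hr μ j)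
  rw [mul_right_comm]
  exact (congrArg norm htsum).trans_le ((norm_tsum_le_tsum_norm hsum).trans hle)

lemma norm_sub_eulerTransform_partialTheta_le (hσ : 0 < σ) (hσ1 : σ ≤ 1 / 10)
    (hre : z.re = σ ^ 2) (him : |z.im| ≤ z.re) (hr : r ≤ 5) (μ : ℕ) {S : ℕ → ℂ}
    (h : ∀ j, S j + S (j + 1) = partialTheta z (μ + j)) (hS : Tendsto S atTop (𝓝 0)) :
    ‖S 0 - eulerTransform r fun j ↦ partialTheta z (μ + j)‖ ≤
      Real.exp 71 * (10 * σ) ^ r * (2 / σ) * (2 / σ) := by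
  obtain ⟨hsum, hle⟩ := tsum_le_of_le_exp_neg_mul hσ (by linarith) (fun _ ↦ norm_nonneg _)
    (norm_fwdDiff_partialTheta_le hσ hσ1 hre him hr μ)
  exact (norm_sub_eulerTransform_le h hS r hsum).trans hle

end SmallParameter

lemma thetaTerm_sub_isLittleO (s t : ℂ) :
    (fun z ↦ thetaTerm z s t - (1 - z * thetaExponent s t)) =o[coneFilter] fun z : ℂ ↦ z := by
  have hderiv : HasDerivAt (fun z ↦ thetaTerm z s t) (-thetaExponent s t) 0 := by
    unfold thetaTerm
    simpa using! ((hasDerivAt_id (0 : ℂ)).neg.mul_const (thetaExponent s t)).cexp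
  have hlittle := (hasDerivAt_iff_isLittleO.mp hderiv).mono (nhdsWithin_le_nhds : coneFilter ≤ 𝓝 0)
  simp only [sub_zero, smul_eq_mul] at hlittle
  refine hlittle.congr_left fun z ↦ ?_
  simp only [thetaTerm, neg_zero, zero_mul, exp_zero]
  ring

lemma eventually_coneFilter_sqrt_re : ∀ᶠ z in coneFilter,
    0 < √z.re ∧ √z.re ≤ 1 / 10 ∧ z.re = √z.re ^ 2 ∧ |z.im| ≤ z.re := by
  have hsmall := tendsto_re_coneFilter.eventually (Ioo_mem_nhdsGT (by norm_num : (0 : ℝ) < 1 / 100))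
  filter_upwards [hsmall, eventually_coneFilter_mem] with z hz ⟨hre, him⟩
  refine ⟨Real.sqrt_pos.mpr hre, ?_, (Real.sq_sqrt hre.le).symm, him⟩
  rw [Real.sqrt_le_left (by norm_num)]
  linarith [hz.2]

lemma isLittleO_of_norm_le_sqrt_re_pow {R : ℂ → ℂ} {C : ℝ}
    (h : ∀ᶠ z in coneFilter, ‖R z‖ ≤ C * √z.re ^ 3) : R =o[coneFilter] fun z : ℂ ↦ z := by
  have hR : R =O[coneFilter] fun z ↦ √z.re ^ 3 :=
    .of_bound C (h.mono fun z hz ↦ by rwa [Real.norm_of_nonneg (by positivity)])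
  have hre : (fun z : ℂ ↦ z.re) =O[coneFilter] fun z ↦ z :=
    .of_bound 1 (.of_forall fun z ↦ by simpa using abs_re_le_norm z)
  have hsqrt : (fun z : ℂ ↦ √z.re) =o[coneFilter] fun _ ↦ (1 : ℝ) := by
    rw [Asymptotics.isLittleO_one_iff]
    exact (Real.continuous_sqrt.tendsto' 0 0 Real.sqrt_zero).comp
      (tendsto_re_coneFilter.mono_right nhdsWithin_le_nhds)
  refine hR.trans_isLittleO (Asymptotics.IsLittleO.of_norm_right
    ((hsqrt.mul_isBigO hre.norm_right).congr' ?_ (by simp)))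
  filter_upwards [eventually_coneFilter_mem] with z hz
  rw [pow_succ', Real.sq_sqrt hz.1.le]

-- Each summation costs a factor `2 / σ`, where `σ = √z.re`, so the truncation at order `4` here and
-- at order `5` in the double sum below both leave an error `O(σ ^ 3) = o(z)`.
lemma partialTheta_sub_isLittleO (μ : ℕ) :
    (fun z ↦ partialTheta z μ - (1 / 2 - z * eulerTransform 4 fun k : ℕ ↦ thetaExponent μ k))
      =o[coneFilter] fun z : ℂ ↦ z := by
  have herror : (fun z ↦ partialTheta z μ - eulerTransform 4 fun k : ℕ ↦ thetaTerm z μ k)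
      =o[coneFilter] fun z : ℂ ↦ z := by
    refine isLittleO_of_norm_le_sqrt_re_pow (C := Real.exp 71 * 10 ^ 4 * 2) ?_
    filter_upwards [eventually_coneFilter_sqrt_re] with z ⟨hσ, hσ1, hre, him⟩
    refine (norm_partialTheta_sub_eulerTransform_le hσ hσ1 hre him (by norm_num) μ).trans_eq ?_
    field_simp
  have hterms := isLittleO_eulerTransform (fun k : ℕ ↦ thetaTerm_sub_isLittleO μ k) 4
  refine (herror.add hterms).congr_left fun z ↦ ?_
  rw [eulerTransform_sub, eulerTransform_sub, eulerTransform_const four_ne_zero,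
    eulerTransform_const_mul, real_smul]
  push_cast
  ring

/-- The coefficient of `-z` in the expansion at `z = 0` of the null solution `S` of
`S j + S (j + 1) = partialTheta z (μ + j)`. -/
noncomputable def linearCoeff (μ : ℕ) : ℂ :=
  eulerTransform 5 fun j ↦ eulerTransform 4 fun k : ℕ ↦ thetaExponent (μ + j : ℕ) k

lemma linearCoeff_succ_sub (μ : ℕ) :
    linearCoeff (μ + 2) - linearCoeff (μ + 1) = (2 * μ + 1) / 8 := by
  simp only [linearCoeff, eulerTransform, thetaExponent, Finset.sum_range_succ,
    Finset.sum_range_zero, Function.iterate_succ_apply', Function.iterate_zero_apply, fwdDiff,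
    real_smul]
  push_cast
  ring

lemma sub_linear_isLittleO (μ : ℕ) {S : ℂ → ℕ → ℂ}
    (h : ∀ z : ℂ, 0 < z.re → ∀ j, S z j + S z (j + 1) = partialTheta z (μ + j))
    (hS : ∀ z : ℂ, 0 < z.re → Tendsto (S z) atTop (𝓝 0)) :
    (fun z ↦ S z 0 - (1 / 4 - z * linearCoeff μ)) =o[coneFilter] fun z : ℂ ↦ z := by
  have herror : (fun z ↦ S z 0 - eulerTransform 5 fun j ↦ partialTheta z (μ + j))
      =o[coneFilter] fun z : ℂ ↦ z := by
    refine isLittleO_of_norm_le_sqrt_re_pow (C := Real.exp 71 * 10 ^ 5 * 4) ?_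
    filter_upwards [eventually_coneFilter_sqrt_re, eventually_coneFilter_mem]
      with z ⟨hσ, hσ1, hre, him⟩ ⟨hpos, _⟩
    refine (norm_sub_eulerTransform_partialTheta_le hσ hσ1 hre him le_rfl μ (h z hpos)
      (hS z hpos)).trans_eq ?_
    field_simp
    ring
  have hterms := isLittleO_eulerTransform (fun j ↦ partialTheta_sub_isLittleO (μ + j)) 5
  refine (herror.add hterms).congr_left fun z ↦ ?_
  rw [eulerTransform_sub, eulerTransform_sub, eulerTransform_const (by norm_num),
    eulerTransform_const_mul, real_smul, linearCoeff]
  push_cast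
  ring

/-! ### Cauchy's formula -/

lemma integral_exp_int_mul_I {l : ℤ} (hl : l ≠ 0) : ∫ y in -π..π, exp (l * I * y) = 0 := by
  have hperiod : exp (l * I * π) = exp (l * I * (-π : ℝ)) :=
    exp_eq_exp_iff_exists_int.mpr ⟨l, by push_cast; ring⟩
  rw [integral_exp_mul_complex (mul_ne_zero (Int.cast_ne_zero.mpr hl) I_ne_zero), hperiod, sub_self,
    zero_div]

lemma integral_exp_neg_pow_mul_exp (x : ℝ) (k n : ℕ) :
    ∫ y in -π..π, exp (-(x + y * I)) ^ k * exp (n * (x + y * I)) =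
      if k = n then (2 * π : ℂ) else 0 := by
  have hsplit (y : ℝ) : exp (-(x + y * I)) ^ k * exp (n * (x + y * I)) =
      exp ((n - k) * x) * exp ((n - k : ℤ) * I * y) := by
    rw [← exp_nat_mul, ← exp_add, ← exp_add]
    push_cast
    ring_nf
  simp only [hsplit, intervalIntegral.integral_const_mul]
  split_ifs with hk
  · simp [hk, two_mul]
  · rw [integral_exp_int_mul_I (by omega), mul_zero]

section Cauchy

variable {a : ℕ → ℂ} {f : ℂ → ℂ} {x : ℝ}

lemma norm_mul_exp_neg_pow (a : ℂ) (x y : ℝ) (k : ℕ) :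
    ‖a * exp (-(x + y * I)) ^ k‖ = ‖a * exp (-(x : ℂ)) ^ k‖ := by
  simp [norm_exp]

lemma summable_norm_mul_exp_neg_pow
    (h : ∀ z : ℂ, z.re = x → HasSum (fun n ↦ a n * exp (-z) ^ n) (f z)) :
    Summable fun n ↦ ‖a n * exp (-(x : ℂ)) ^ n‖ :=
  (h x (ofReal_re x)).summable.norm

lemma continuous_of_hasSum_mul_exp_neg_pow
    (h : ∀ z : ℂ, z.re = x → HasSum (fun n ↦ a n * exp (-z) ^ n) (f z)) :
    Continuous fun y : ℝ ↦ f (x + y * I) := by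
  have htsum : (fun y : ℝ ↦ f (x + y * I)) = fun y : ℝ ↦ ∑' n, a n * exp (-(x + y * I)) ^ n :=
    funext fun y ↦ (h _ (by simp)).tsum_eq.symm
  rw [htsum]
  exact continuous_tsum (fun n ↦ by fun_prop) (summable_norm_mul_exp_neg_pow h)
    fun n y ↦ (norm_mul_exp_neg_pow (a n) x y n).le

lemma integral_mul_exp_eq_two_pi_mul_coeff
    (h : ∀ z : ℂ, z.re = x → HasSum (fun n ↦ a n * exp (-z) ^ n) (f z)) (n : ℕ) :
    ∫ y in -π..π, f (x + y * I) * exp (n * (x + y * I)) = 2 * π * a n := by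
  have hsum := intervalIntegral.hasSum_integral_of_dominated_convergence (μ := volume)
    (a := -π) (b := π)
    (F := fun (k : ℕ) (y : ℝ) ↦ a k * exp (-(x + y * I)) ^ k * exp (n * (x + y * I)))
    (fun k _ ↦ ‖a k * exp (-(x : ℂ)) ^ k‖ * Real.exp (n * x))
    (fun k ↦ Continuous.aestronglyMeasurable (by fun_prop))
    (fun k ↦ .of_forall fun y _ ↦ by
      rw [norm_mul, norm_mul_exp_neg_pow, norm_exp (n * _)]
      simp)
    (.of_forall fun y _ ↦ (summable_norm_mul_exp_neg_pow h).mul_right _)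
    (by simp) (.of_forall fun y _ ↦ (h (x + y * I) (by simp)).mul_right _)
  have hterm (k : ℕ) : ∫ y in -π..π, a k * exp (-(x + y * I)) ^ k * exp (n * (x + y * I)) =
      if k = n then 2 * π * a n else 0 := by
    simp only [mul_assoc, intervalIntegral.integral_const_mul, integral_exp_neg_pow_mul_exp]
    split_ifs with hk
    · rw [hk]
      ring
    · rw [mul_zero]
  refine hsum.unique ?_
  simp only [hterm]
  exact hasSum_ite_eq n _

end Cauchy

/-! ### Laplace's method -/

lemma one_add_mul_I_ne_zero (θ : ℝ) : (1 + θ * I : ℂ) ≠ 0 := ne_zero_of_re_pos (by simp)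

lemma norm_one_add_mul_I_le {θ : ℝ} (hθ : |θ| ≤ 1) : ‖(1 + θ * I : ℂ)‖ ≤ 2 := by
  simpa using norm_le_two_mul_re (z := 1 + θ * I) (by simpa)

lemma norm_exp_neg_sq_div_le (φ : ℝ) {θ : ℝ} (hθ : |θ| ≤ 1) :
    ‖exp (-(φ ^ 2 / (1 + θ * I)))‖ ≤ Real.exp (-(1 / 2) * φ ^ 2) := by
  have hnorm : normSq (1 + θ * I) = 1 + θ ^ 2 := by simp [normSq_apply, sq]
  have hθ2 : θ ^ 2 ≤ 1 := by rwa [sq_le_one_iff_abs_le_one]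
  have hhalf : 1 / 2 ≤ 1 / (1 + θ ^ 2) := one_div_le_one_div_of_le (by positivity) (by linarith)
  rw [norm_exp, Real.exp_le_exp, neg_re, div_eq_mul_inv, ← ofReal_pow, re_ofReal_mul, inv_re, hnorm]
  simp only [add_re, one_re, re_ofReal_mul, I_re, mul_zero, add_zero]
  nlinarith [sq_nonneg φ]

lemma integral_exp_neg_sq_mul_const (c : ℂ) : ∫ φ : ℝ, exp (-(φ ^ 2)) * c = √π * c := by
  have hreal (φ : ℝ) : exp (-(φ ^ 2 : ℂ)) = (Real.exp (-1 * φ ^ 2) : ℝ) := by simp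
  simp only [integral_mul_const, hreal]
  rw [integral_complex_ofReal, integral_gaussian, div_one]

lemma sqrt_mul_integral_eq_integral_indicator {A : ℝ} (hA : 0 < A) (g : ℝ → ℂ) :
    √A * ∫ θ in -1..1, exp (-(A * θ ^ 2 / (1 + θ * I))) * g θ =
      ∫ φ, (Set.Ioc (-√A) (√A)).indicator
        (fun φ ↦ exp (-(φ ^ 2 / (1 + (φ / √A : ℝ) * I))) * g (φ / √A)) φ := by
  have hsqrt : 0 < √A := Real.sqrt_pos.mpr hA
  have hsub := intervalIntegral.integral_comp_div (a := -√A) (b := √A)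
    (fun θ : ℝ ↦ exp (-(A * θ ^ 2 / (1 + θ * I))) * g θ) hsqrt.ne'
  rw [neg_div, div_self hsqrt.ne', real_smul] at hsub
  rw [← hsub, integral_indicator measurableSet_Ioc,
    ← intervalIntegral.integral_of_le (by linarith)]
  congr! with φ
  norm_cast
  rw [div_pow, Real.sq_sqrt hA.le, mul_div_cancel₀ _ hA.ne']

section Laplace

variable {ι : Type*} {l : Filter ι} {A : ι → ℝ} {h : ι → ℝ → ℂ} {c : ℂ}

lemma tendsto_div_sqrt (hA : Tendsto A l atTop) (φ : ℝ) :
    Tendsto (fun i ↦ φ / √(A i)) l (𝓝 0) :=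
  tendsto_const_nhds.div_atTop (Real.tendsto_sqrt_atTop.comp hA)

lemma tendsto_indicator_exp_neg_sq (hA : Tendsto A l atTop)
    (hlim : Tendsto (Function.uncurry h) (l ×ˢ 𝓝 0) (𝓝 c)) (φ : ℝ) :
    Tendsto (fun i ↦ (Set.Ioc (-√(A i)) (√(A i))).indicator
        (fun φ ↦ exp (-(φ ^ 2 / (1 + (φ / √(A i) : ℝ) * I))) * h i (φ / √(A i))) φ)
      l (𝓝 (exp (-(φ ^ 2)) * c)) := by
  have hexp : Continuous fun θ : ℝ ↦ exp (-(φ ^ 2 / (1 + θ * I))) :=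
    (continuous_const.div (by fun_prop) one_add_mul_I_ne_zero).neg.cexp
  have hθ := tendsto_div_sqrt hA φ
  refine (((hexp.tendsto' 0 _ (by simp)).comp hθ).mul
    (hlim.comp (tendsto_id.prodMk hθ))).congr' ?_
  filter_upwards [(Real.tendsto_sqrt_atTop.comp hA).eventually_gt_atTop |φ|] with i hi
  have hmem : φ ∈ Set.Ioc (-√(A i)) (√(A i)) := ⟨(abs_lt.mp hi).1, (abs_lt.mp hi).2.le⟩
  rw [Set.indicator_of_mem hmem]
  rfl

lemma tendsto_sqrt_mul_integral_exp_neg_sq [l.IsCountablyGenerated] (hA : Tendsto A l atTop)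
    (hcont : ∀ᶠ i in l, Continuous (h i)) {M : ℝ} (hM : ∀ᶠ i in l, ∀ θ, |θ| ≤ 1 → ‖h i θ‖ ≤ M)
    (hlim : Tendsto (Function.uncurry h) (l ×ˢ 𝓝 0) (𝓝 c)) :
    Tendsto (fun i ↦ √(A i) * ∫ θ in -1..1, exp (-(A i * θ ^ 2 / (1 + θ * I))) * h i θ) l
      (𝓝 (√π * c)) := by
  rw [← integral_exp_neg_sq_mul_const]
  refine Tendsto.congr' ((hA.eventually_gt_atTop 0).mono fun i hi ↦
    (sqrt_mul_integral_eq_integral_indicator hi (h i)).symm) ?_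
  refine tendsto_integral_filter_of_dominated_convergence
    (fun φ ↦ Real.exp (-(1 / 2) * φ ^ 2) * M) ?_ ?_
    ((integrable_exp_neg_mul_sq (by norm_num)).mul_const _)
    (.of_forall (tendsto_indicator_exp_neg_sq hA hlim))
  · filter_upwards [hcont] with i hi
    refine AEStronglyMeasurable.indicator (Continuous.aestronglyMeasurable ?_) measurableSet_Ioc
    refine .mul (.cexp (.neg (.div (by fun_prop) (by fun_prop) fun φ ↦ ?_))) (hi.comp (by fun_prop))
    exact one_add_mul_I_ne_zero _
  · filter_upwards [hM, hA.eventually_gt_atTop 0] with i hi hAi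
    refine .of_forall fun φ ↦ ?_
    have hM0 : 0 ≤ M := (norm_nonneg _).trans (hi 0 (by simp))
    rw [Set.indicator]
    split_ifs with hφ
    · have hθ : |φ / √(A i)| ≤ 1 := by
        rw [abs_div, abs_of_nonneg (Real.sqrt_nonneg _), div_le_one (Real.sqrt_pos.mpr hAi), abs_le]
        exact ⟨hφ.1.le, hφ.2⟩
      rw [norm_mul]
      gcongr
      exacts [norm_exp_neg_sq_div_le φ hθ, hi _ hθ]
    · rw [norm_zero]
      positivity

end Laplace

/-! ### The circle method -/

lemma eventually_forall_abs_le_of_coneFilter {P : ℂ → Prop} (hP : ∀ᶠ z in coneFilter, P z) :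
    ∀ᶠ x : ℝ in 𝓝[>] 0, ∀ y : ℝ, |y| ≤ x → P (x + y * I) := by
  rw [coneFilter, eventually_nhdsWithin_iff, Metric.eventually_nhds_iff] at hP
  obtain ⟨ε, hε, hP⟩ := hP
  filter_upwards [Ioo_mem_nhdsGT (half_pos hε)] with x ⟨hx, hxε⟩ y hy
  have hcone : |(x + y * I : ℂ).im| ≤ (x + y * I : ℂ).re := by simpa using hy
  have hnorm := norm_le_two_mul_re hcone
  simp only [add_re, ofReal_re, re_ofReal_mul, I_re, mul_zero, add_zero] at hnorm
  refine hP ?_ ⟨by simpa using hx, hcone⟩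
  rw [dist_zero_right]
  linarith

lemma tendsto_cone_point : Tendsto (fun p : ℝ × ℝ ↦ (p.1 + (p.1 * p.2 : ℝ) * I : ℂ))
    (𝓝[>] 0 ×ˢ 𝓝 0) coneFilter := fun s hs ↦ by
  have hsmall : ∀ᶠ θ : ℝ in 𝓝 0, |θ| ≤ 1 :=
    (continuous_abs.tendsto' 0 0 abs_zero).eventually (Iic_mem_nhds one_pos)
  change ∀ᶠ p : ℝ × ℝ in 𝓝[>] 0 ×ˢ 𝓝 0, (p.1 + (p.1 * p.2 : ℝ) * I : ℂ) ∈ s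
  filter_upwards [((eventually_forall_abs_le_of_coneFilter hs).and
    self_mem_nhdsWithin).prod_mk hsmall] with ⟨x, θ⟩ ⟨⟨hcone, hx⟩, hθ⟩
  refine hcone (x * θ) ?_
  rw [abs_mul, abs_of_pos hx]
  exact mul_le_of_le_one_right (le_of_lt hx) hθ

lemma sq_norm_sqrt (w : ℂ) : ‖sqrt w‖ ^ 2 = ‖w‖ := by
  rcases eq_or_ne w 0 with rfl | hw
  · simp
  · rw [← norm_pow, sqrt_eq_exp hw, ← exp_nat_mul, Nat.cast_ofNat, mul_div_cancel₀ _ two_ne_zero,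
      exp_log hw]

lemma norm_sqrt_le_two {w : ℂ} (hw : ‖w‖ ≤ 4) : ‖sqrt w‖ ≤ 2 := by
  nlinarith [sq_norm_sqrt w, norm_nonneg (sqrt w)]

/-- The integrand in Cauchy's formula for the `n`-th coefficient of `F / eulerProd`, on the circle
`re z = x`, when `n = π ^ 2 / (6 x ^ 2)`, i.e. when `x` is the saddle point. -/
noncomputable def circleIntegrand (F : ℂ → ℂ) (x y : ℝ) : ℂ :=
  F (x + y * I) / eulerProd (exp (-(x + y * I))) * exp (π ^ 2 / (6 * x ^ 2) * (x + y * I))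

/-- The factor of `F z / (z ^ β * eulerProd (exp (-z)))` which remains after removing the leading
behaviour of `1 / eulerProd`. -/
noncomputable def slowFactor (F : ℂ → ℂ) (β : ℕ) (z : ℂ) : ℂ :=
  exp (-z / 24) / eulerProd (exp (-(4 * π ^ 2 / z))) * (F z / z ^ β)

/-- The amplitude multiplying the Gaussian on the major arc `y = x θ`, `|θ| ≤ 1`. -/
noncomputable def majorAmplitude (F : ℂ → ℂ) (β : ℕ) (x θ : ℝ) : ℂ :=
  sqrt (1 + θ * I) * (1 + θ * I) ^ β * slowFactor F β (x + (x * θ : ℝ) * I)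

section CircleMethod

variable {F : ℂ → ℂ} {β : ℕ} {x : ℝ} {c : ℂ}

lemma div_eulerProd_eq {z : ℂ} (hz : 0 < z.re) :
    F z / eulerProd (exp (-z)) =
      sqrt (z / (2 * π)) * z ^ β * exp (π ^ 2 / (6 * z)) * slowFactor F β z := by
  have hz0 := ne_zero_of_re_pos hz
  rw [div_eq_mul_inv, inv_eulerProd_exp_neg hz, slowFactor]
  field_simp

lemma saddle_exponent_eq (hx : 0 < x) (θ : ℝ) :
    π ^ 2 / (6 * (x * (1 + θ * I))) + π ^ 2 / (6 * x ^ 2) * (x * (1 + θ * I)) =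
      (2 * (π ^ 2 / (6 * x)) + -((π ^ 2 / (6 * x) : ℝ) * θ ^ 2 / (1 + θ * I)) : ℂ) := by
  have hx0 : (x : ℂ) ≠ 0 := ofReal_ne_zero.mpr hx.ne'
  have hw := one_add_mul_I_ne_zero θ
  push_cast
  field_simp
  linear_combination (θ : ℂ) ^ 2 * I_sq

lemma circleIntegrand_mul_eq (F : ℂ → ℂ) (β : ℕ) (hx : 0 < x) (θ : ℝ) :
    circleIntegrand F x (x * θ) =
      (√(x / (2 * π)) * x ^ β * Real.exp (2 * (π ^ 2 / (6 * x))) : ℝ) *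
        (exp (-((π ^ 2 / (6 * x) : ℝ) * θ ^ 2 / (1 + θ * I))) * majorAmplitude F β x θ) := by
  have hzw : (x + (x * θ : ℝ) * I : ℂ) = x * (1 + θ * I) := by
    push_cast
    ring
  have hsqrt : sqrt (x * (1 + θ * I) / (2 * π)) = √(x / (2 * π)) * sqrt (1 + θ * I) := by
    rw [← sqrt_ofReal_mul (by positivity) (one_add_mul_I_ne_zero θ)]
    push_cast
    ring_nf
  have hexp := congrArg exp (saddle_exponent_eq hx θ)
  rw [exp_add, exp_add] at hexp
  rw [circleIntegrand, div_eulerProd_eq (β := β) (by simpa using hx), majorAmplitude, hzw, hsqrt,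
    mul_pow]
  push_cast at hexp ⊢
  linear_combination √(x / (2 * π)) * sqrt (1 + θ * I) * (x ^ β * (1 + θ * I) ^ β) *
    slowFactor F β (x * (1 + θ * I)) * hexp

lemma tendsto_slowFactor (hF : Tendsto (fun z ↦ F z / z ^ β) coneFilter (𝓝 c)) :
    Tendsto (slowFactor F β) coneFilter (𝓝 c) := by
  simpa [slowFactor] using! tendsto_exp_div_eulerProd_dual.mul hF

lemma tendsto_majorAmplitude (hF : Tendsto (fun z ↦ F z / z ^ β) coneFilter (𝓝 c)) :
    Tendsto (Function.uncurry (majorAmplitude F β)) (𝓝[>] 0 ×ˢ 𝓝 0) (𝓝 c) := by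
  have hcont : ContinuousAt (fun θ : ℝ ↦ sqrt (1 + θ * I) * (1 + θ * I) ^ β) 0 := by
    refine ContinuousAt.mul (ContinuousAt.comp (g := sqrt) ?_ (by fun_prop)) (by fun_prop)
    exact (differentiableAt_sqrt (by simp)).continuousAt
  have hone : Tendsto (fun θ : ℝ ↦ sqrt (1 + θ * I) * (1 + θ * I) ^ β) (𝓝 0) (𝓝 1) := by
    simpa [ContinuousAt, sqrt_eq_exp one_ne_zero] using hcont
  rw [← one_mul c]
  exact (hone.comp tendsto_snd).mul ((tendsto_slowFactor hF).comp tendsto_cone_point)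

lemma eventually_norm_majorAmplitude_le (hF : Tendsto (fun z ↦ F z / z ^ β) coneFilter (𝓝 c)) :
    ∀ᶠ x in 𝓝[>] 0, ∀ θ, |θ| ≤ 1 → ‖majorAmplitude F β x θ‖ ≤ 2 * 2 ^ β * (‖c‖ + 1) := by
  have hbound := (tendsto_slowFactor hF).norm.eventually (gt_mem_nhds (lt_add_one ‖c‖))
  filter_upwards [eventually_forall_abs_le_of_coneFilter hbound, self_mem_nhdsWithin]
    with x hcone hx θ hθ
  have hslow := hcone (x * θ) <| by
    rw [abs_mul, abs_of_pos hx]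
    exact mul_le_of_le_one_right (le_of_lt hx) hθ
  have hw := norm_one_add_mul_I_le hθ
  rw [majorAmplitude, norm_mul, norm_mul, norm_pow]
  gcongr
  exact norm_sqrt_le_two (by linarith)

lemma continuous_majorAmplitude (hx : 0 < x) (hcont : Continuous (circleIntegrand F x)) :
    Continuous (majorAmplitude F β x) := by
  set C : ℂ := ((√(x / (2 * π)) * x ^ β * Real.exp (2 * (π ^ 2 / (6 * x))) : ℝ) : ℂ) with hC
  have hC0 : C ≠ 0 := ofReal_ne_zero.mpr (by positivity)
  have heq : majorAmplitude F β x = fun θ ↦ circleIntegrand F x (x * θ) /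
      (C * exp (-((π ^ 2 / (6 * x) : ℝ) * θ ^ 2 / (1 + θ * I)))) := by
    funext θ
    rw [circleIntegrand_mul_eq F β hx, ← hC]
    field_simp
  rw [heq]
  exact (hcont.comp (by fun_prop)).div (continuous_const.mul
    (continuous_const.mul (by fun_prop) |>.div (by fun_prop) one_add_mul_I_ne_zero).neg.cexp)
    fun θ ↦ mul_ne_zero hC0 (exp_ne_zero _)

lemma major_arc_constant_eq (β : ℕ) (hx : 0 < x) :
    x * (√(x / (2 * π)) * x ^ β * Real.exp (2 * (π ^ 2 / (6 * x)))) =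
      √(3 / π ^ 3) * √(π ^ 2 / (6 * x)) * (x ^ (β + 2) * Real.exp (2 * (π ^ 2 / (6 * x)))) := by
  have hsqrt : √(3 / π ^ 3) * √(π ^ 2 / (6 * x)) * x = √(x / (2 * π)) := by
    nth_rewrite 2 [← Real.sqrt_sq hx.le]
    rw [← Real.sqrt_mul (by positivity), ← Real.sqrt_mul (by positivity)]
    congr 1
    field_simp
    norm_num
  rw [← hsqrt]
  ring

lemma tendsto_major_arc (hcont : ∀ x, 0 < x → Continuous (circleIntegrand F x))
    (hF : Tendsto (fun z ↦ F z / z ^ β) coneFilter (𝓝 c)) :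
    Tendsto (fun x ↦ (∫ y in -x..x, circleIntegrand F x y) /
        (x ^ (β + 2) * Real.exp (2 * (π ^ 2 / (6 * x))) : ℝ))
      (𝓝[>] 0) (𝓝 ((√3 / π : ℝ) * c)) := by
  have hA : Tendsto (fun x : ℝ ↦ π ^ 2 / (6 * x)) (𝓝[>] 0) atTop := by
    refine (tendsto_inv_nhdsGT_zero.const_mul_atTop (r := π ^ 2 / 6) (by positivity)).congr
      fun x ↦ by ring
  have hconst : √(3 / π ^ 3) * √π = √3 / π := by
    rw [← Real.sqrt_mul (by positivity), show 3 / π ^ 3 * π = 3 / π ^ 2 by field_simp,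
      Real.sqrt_div (by norm_num), Real.sqrt_sq Real.pi_pos.le]
  rw [← hconst, ofReal_mul, mul_assoc]
  refine ((tendsto_sqrt_mul_integral_exp_neg_sq hA
    (eventually_mem_nhdsWithin.mono fun x hx ↦ continuous_majorAmplitude hx (hcont x hx))
    (eventually_norm_majorAmplitude_le hF) (tendsto_majorAmplitude hF)).const_mul _).congr' ?_
  filter_upwards [self_mem_nhdsWithin] with x (hx : 0 < x)
  have hsub := intervalIntegral.smul_integral_comp_mul_left (a := -1) (b := 1)
    (circleIntegrand F x) x
  rw [mul_neg, mul_one] at hsub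
  have hconst' : (x : ℂ) * (√(x / (2 * π)) * x ^ β * Real.exp (2 * (π ^ 2 / (6 * x))) : ℝ) =
      √(3 / π ^ 3) * √(π ^ 2 / (6 * x)) * (x ^ (β + 2) * Real.exp (2 * (π ^ 2 / (6 * x))) : ℝ) :=
    mod_cast major_arc_constant_eq β hx
  have hne : (x ^ (β + 2) * Real.exp (2 * (π ^ 2 / (6 * x))) : ℝ) ≠ 0 := by positivity
  simp only [← hsub, circleIntegrand_mul_eq F β hx, intervalIntegral.integral_const_mul]
  rw [real_smul, ← mul_assoc (x : ℂ), hconst', eq_div_iff (ofReal_ne_zero.mpr hne)]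
  ring

lemma norm_exp_sub_one_sq (x y : ℝ) :
    ‖exp (x + y * I) - 1‖ ^ 2 = (Real.exp x - 1) ^ 2 + 2 * Real.exp x * (1 - Real.cos y) := by
  rw [← normSq_eq_norm_sq, normSq_apply]
  simp only [sub_re, sub_im, exp_re, exp_im, one_re, one_im, add_re, add_im, ofReal_re, ofReal_im,
    re_ofReal_mul, im_ofReal_mul, I_re, I_im, mul_zero, mul_one, add_zero, zero_add, sub_zero]
  linear_combination Real.exp x ^ 2 * Real.sin_sq_add_cos_sq y

lemma mul_le_norm_exp_sub_one {x y : ℝ} (hx : 0 ≤ x) (hxy : x ≤ |y|) (hy : |y| ≤ π) :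
    10 / 9 * x ≤ ‖exp (x + y * I) - 1‖ := by
  have hexp : x + 1 ≤ Real.exp x := Real.add_one_le_exp x
  have hpi : 1 / 5 ≤ 2 / π ^ 2 := by
    rw [div_le_div_iff₀ (by norm_num) (by positivity)]
    nlinarith [Real.pi_lt_d2, Real.pi_pos]
  have hcos : 1 / 5 * x ^ 2 ≤ 1 - Real.cos y := by
    have hsq : x ^ 2 ≤ y ^ 2 := by
      rw [← sq_abs y]
      gcongr
    nlinarith [Real.cos_le_one_sub_mul_cos_sq hy, sq_nonneg y]
  refine le_of_sq_le_sq ?_ (norm_nonneg _)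
  rw [norm_exp_sub_one_sq]
  nlinarith [sq_nonneg x]

lemma exp_neg_div_one_sub_exp_neg (z : ℂ) :
    exp (-z) / (1 - exp (-z)) = (exp z - 1)⁻¹ := by
  rw [exp_neg, ← inv_inv (exp z - 1), ← one_div_one_div (exp z - 1)]
  field_simp

lemma inv_sub_one_le_exp_neg_div {x : ℝ} (hx : 0 < x) :
    x⁻¹ - 1 ≤ Real.exp (-x) / (1 - Real.exp (-x)) := by
  have hlt : 0 < 1 - Real.exp (-x) := by simpa using hx
  have hle : x⁻¹ ≤ (1 - Real.exp (-x))⁻¹ :=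
    inv_anti₀ hlt (by linarith [Real.one_sub_le_exp_neg x])
  have hsplit : Real.exp (-x) / (1 - Real.exp (-x)) = (1 - Real.exp (-x))⁻¹ - 1 := by
    field_simp
    ring
  linarith

lemma re_exp_neg_div_sub_le {x y : ℝ} (hx : 0 < x) (hxy : x ≤ |y|) (hy : |y| ≤ π) :
    (exp (-(x + y * I)) / (1 - exp (-(x + y * I)))).re -
      Real.exp (-x) / (1 - Real.exp (-x)) ≤ 1 - x⁻¹ / 10 := by
  have hre : ((exp (x + y * I) - 1)⁻¹).re ≤ 9 / 10 * x⁻¹ := calc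
    _ ≤ ‖exp (x + y * I) - 1‖⁻¹ := (re_le_norm _).trans_eq (norm_inv _)
    _ ≤ (10 / 9 * x)⁻¹ := inv_anti₀ (by positivity) (mul_le_norm_exp_sub_one hx.le hxy hy)
    _ = _ := by rw [mul_inv, inv_div]
  rw [exp_neg_div_one_sub_exp_neg]
  linarith [inv_sub_one_le_exp_neg_div hx]

lemma eventually_norm_inv_eulerProd_exp_neg_le :
    ∀ᶠ x : ℝ in 𝓝[>] 0, ‖(eulerProd (Real.exp (-x) : ℝ))⁻¹‖ ≤ 4 * Real.exp (π ^ 2 / (6 * x)) := by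
  have hdual := tendsto_exp_div_eulerProd_dual.norm.eventually_le_const
    (show ‖(1 : ℂ)‖ < 2 by norm_num)
  filter_upwards [eventually_forall_abs_le_of_coneFilter hdual, Ioo_mem_nhdsGT one_pos]
    with x hle ⟨hx, hx1⟩
  have hdualx := hle 0 (by simpa using hx.le)
  rw [ofReal_zero, zero_mul, add_zero] at hdualx
  have hsqrt : ‖sqrt (x / (2 * π))‖ ≤ 2 := norm_sqrt_le_two <| by
    rw [← ofReal_ofNat, ← ofReal_mul, ← ofReal_div, Complex.norm_of_nonneg (by positivity),
      div_le_iff₀ (by positivity)]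
    linarith [Real.pi_gt_three]
  have hexp : ‖exp ((π : ℂ) ^ 2 / (6 * x))‖ = Real.exp (π ^ 2 / (6 * x)) := by
    rw [norm_exp]
    norm_cast
  rw [ofReal_exp, ofReal_neg, inv_eulerProd_exp_neg (by simpa), norm_mul, norm_mul, hexp]
  calc _ ≤ 2 * Real.exp (π ^ 2 / (6 * x)) * 2 := by gcongr
    _ = _ := by ring

lemma eventually_norm_circleIntegrand_le {C : ℝ} {K : ℕ}
    (hC : ∀ z : ℂ, 0 < z.re → z.re ≤ 1 → ‖F z‖ ≤ C / z.re ^ K) :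
    ∀ᶠ x : ℝ in 𝓝[>] 0, ∀ y : ℝ, x ≤ |y| → |y| ≤ π →
      ‖circleIntegrand F x y‖ ≤
        4 * C / x ^ K * Real.exp (1 - x⁻¹ / 10) * Real.exp (2 * (π ^ 2 / (6 * x))) := by
  filter_upwards [eventually_norm_inv_eulerProd_exp_neg_le, Ioo_mem_nhdsGT one_pos]
    with x hreal ⟨hx, hx1⟩ y hxy hy
  have hre : (x + y * I : ℂ).re = x := by simp
  have hFz := hC (x + y * I) (by rwa [hre]) (by rw [hre]; exact hx1.le)
  have hnorm : ‖exp (-(x + y * I))‖ = Real.exp (-x) := by simp [norm_exp]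
  have hinv : ‖(eulerProd (exp (-(x + y * I))))⁻¹‖ ≤
      4 * Real.exp (π ^ 2 / (6 * x)) * Real.exp (1 - x⁻¹ / 10) := by
    refine (norm_inv_eulerProd_le (norm_exp_neg_lt_one (by rwa [hre]))).trans ?_
    rw [hnorm]
    refine mul_le_mul hreal (Real.exp_le_exp.mpr ?_) (Real.exp_pos _).le (by positivity)
    exact re_exp_neg_div_sub_le hx hxy hy
  have hexp : ‖exp (π ^ 2 / (6 * x ^ 2) * (x + y * I))‖ = Real.exp (π ^ 2 / (6 * x)) := by
    have hcoe : (π ^ 2 / (6 * x ^ 2) : ℂ) = (π ^ 2 / (6 * x ^ 2) : ℝ) := by push_cast; rfl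
    rw [norm_exp, hcoe, re_ofReal_mul, hre]
    congr 1
    field_simp
  rw [hre] at hFz
  rw [circleIntegrand, norm_mul, div_eq_mul_inv, norm_mul, hexp]
  calc _ ≤ C / x ^ K * (4 * Real.exp (π ^ 2 / (6 * x)) * Real.exp (1 - x⁻¹ / 10)) *
        Real.exp (π ^ 2 / (6 * x)) := by gcongr; exact (norm_nonneg _).trans hFz
    _ = _ := by
      rw [two_mul, Real.exp_add]
      ring

lemma tendsto_div_pow_mul_exp_neg_inv (C : ℝ) (K : ℕ) :
    Tendsto (fun x : ℝ ↦ C / x ^ K * Real.exp (1 - x⁻¹ / 10)) (𝓝[>] 0) (𝓝 0) := by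
  have hdecay := (tendsto_rpow_mul_exp_neg_mul_atTop_nhds_zero K (1 / 10) (by norm_num)).comp
    tendsto_inv_nhdsGT_zero
  refine (mul_zero (C * Real.exp 1) ▸ hdecay.const_mul (C * Real.exp 1)).congr fun x ↦ ?_
  rw [Function.comp_apply, Real.rpow_natCast, inv_pow, sub_eq_add_neg, Real.exp_add,
    show -(x⁻¹ / 10) = -(1 / 10) * x⁻¹ by ring]
  ring

lemma norm_integral_sub_integral_le {E : Type*} [NormedAddCommGroup E] [NormedSpace ℝ E]
    {f : ℝ → E} (hf : Continuous f) {x R B : ℝ} (hx : 0 ≤ x) (hxR : x ≤ R)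
    (hB : ∀ y, x ≤ |y| → |y| ≤ R → ‖f y‖ ≤ B) :
    ‖(∫ y in -R..R, f y) - ∫ y in -x..x, f y‖ ≤ 2 * R * B := by
  have hB0 : 0 ≤ B := (norm_nonneg _).trans (hB x (le_abs_self x) (by rwa [abs_of_nonneg hx]))
  have hleft : ‖∫ y in -R..-x, f y‖ ≤ B * |-x - -R| :=
    intervalIntegral.norm_integral_le_of_norm_le_const fun y hy ↦ by
      rw [Set.uIoc_of_le (by linarith)] at hy
      refine hB y ?_ ?_ <;> rw [abs_of_nonpos (by linarith [hy.2])] <;> linarith [hy.1, hy.2]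
  have hright : ‖∫ y in R..x, f y‖ ≤ B * |x - R| :=
    intervalIntegral.norm_integral_le_of_norm_le_const fun y hy ↦ by
      rw [Set.uIoc_of_ge hxR] at hy
      refine hB y ?_ ?_ <;> rw [abs_of_nonneg (by linarith [hy.1])] <;> linarith [hy.1, hy.2]
  rw [abs_of_nonneg (by linarith)] at hleft
  rw [abs_of_nonpos (by linarith)] at hright
  rw [intervalIntegral.integral_interval_sub_interval_comm (hf.intervalIntegrable _ _)
    (hf.intervalIntegrable _ _) (hf.intervalIntegrable _ _)]
  calc _ ≤ _ := norm_sub_le _ _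
    _ ≤ B * (-x - -R) + B * -(x - R) := add_le_add hleft hright
    _ ≤ 2 * R * B := by nlinarith

lemma tendsto_minor_arc (β : ℕ) (hcont : ∀ x, 0 < x → Continuous (circleIntegrand F x)) {C : ℝ}
    {K : ℕ} (hC : ∀ z : ℂ, 0 < z.re → z.re ≤ 1 → ‖F z‖ ≤ C / z.re ^ K) :
    Tendsto (fun x ↦ ((∫ y in -π..π, circleIntegrand F x y) - ∫ y in -x..x, circleIntegrand F x y) /
        (x ^ (β + 2) * Real.exp (2 * (π ^ 2 / (6 * x))) : ℝ))
      (𝓝[>] 0) (𝓝 0) := by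
  refine squeeze_zero_norm' ?_
    (tendsto_div_pow_mul_exp_neg_inv (2 * π * (4 * C)) (K + (β + 2)))
  filter_upwards [eventually_norm_circleIntegrand_le hC, Ioo_mem_nhdsGT Real.pi_pos]
    with x hle ⟨hx, hxπ⟩
  rw [norm_div, Complex.norm_of_nonneg (by positivity), div_le_iff₀ (by positivity)]
  refine (norm_integral_sub_integral_le (hcont x hx) hx.le hxπ.le hle).trans_eq ?_
  rw [pow_add]
  field_simp

lemma tendsto_integral_circleIntegrand (hcont : ∀ x, 0 < x → Continuous (circleIntegrand F x))
    {C : ℝ} {K : ℕ} (hC : ∀ z : ℂ, 0 < z.re → z.re ≤ 1 → ‖F z‖ ≤ C / z.re ^ K)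
    (hF : Tendsto (fun z ↦ F z / z ^ β) coneFilter (𝓝 c)) :
    Tendsto (fun x ↦ (∫ y in -π..π, circleIntegrand F x y) /
        (x ^ (β + 2) * Real.exp (2 * (π ^ 2 / (6 * x))) : ℝ))
      (𝓝[>] 0) (𝓝 ((√3 / π : ℝ) * c)) := by
  simpa only [← add_div, sub_add_cancel, zero_add] using
    (tendsto_minor_arc β hcont hC).add (tendsto_major_arc hcont hF)

/-- The radius of the circle used for the `n`-th coefficient: the saddle point of
`exp (π ^ 2 / (6 * x) + n * x)`. -/
noncomputable def saddle (n : ℕ) : ℝ := π / √(6 * n)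

lemma saddle_pos {n : ℕ} (hn : n ≠ 0) : 0 < saddle n := by
  unfold saddle
  positivity

lemma natCast_eq_div_saddle_sq {n : ℕ} (hn : n ≠ 0) : (n : ℝ) = π ^ 2 / (6 * saddle n ^ 2) := by
  rw [saddle, div_pow, Real.sq_sqrt (by positivity)]
  field_simp

lemma tendsto_saddle : Tendsto saddle atTop (𝓝[>] 0) := by
  refine tendsto_nhdsWithin_iff.mpr ⟨tendsto_const_nhds.div_atTop (Real.tendsto_sqrt_atTop.comp
    (tendsto_natCast_atTop_atTop.const_mul_atTop (by norm_num))), ?_⟩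
  filter_upwards [eventually_ne_atTop 0] with n hn using saddle_pos hn

/-- The Hardy–Ramanujan main term for the number of partitions of `n`. -/
noncomputable def partitionScale (n : ℕ) : ℝ :=
  1 / (4 * √3 * n) * Real.exp (π * √(2 * n / 3))

lemma partitionScale_pos {n : ℕ} (hn : n ≠ 0) : 0 < partitionScale n := by
  unfold partitionScale
  positivity

lemma partitionScale_eq {n : ℕ} (hn : n ≠ 0) :
    partitionScale n =
      √3 / (2 * π ^ 2) * (saddle n ^ 2 * Real.exp (2 * (π ^ 2 / (6 * saddle n)))) := by
  have hsaddle := saddle_pos hn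
  have hthree : √3 ^ 2 = 3 := Real.sq_sqrt (by norm_num)
  have hsqrt : √(2 * n / 3) = √(6 * n) / 3 := by
    rw [show (2 * n / 3 : ℝ) = 6 * n / 3 ^ 2 by ring, Real.sqrt_div' _ (by norm_num),
      Real.sqrt_sq (by norm_num)]
  have hexp : π * √(2 * n / 3) = 2 * (π ^ 2 / (6 * saddle n)) := by
    rw [hsqrt, saddle]
    field_simp
    norm_num
  rw [partitionScale, hexp, natCast_eq_div_saddle_sq hn]
  field_simp
  rw [hthree]
  norm_num

lemma tendsto_coeff_div {a : ℕ → ℂ}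
    (ha : ∀ z : ℂ, 0 < z.re → HasSum (fun n ↦ a n * exp (-z) ^ n) (F z / eulerProd (exp (-z))))
    {C : ℝ} {K : ℕ} (hC : ∀ z : ℂ, 0 < z.re → z.re ≤ 1 → ‖F z‖ ≤ C / z.re ^ K)
    (hF : Tendsto (fun z ↦ F z / z ^ β) coneFilter (𝓝 c)) :
    Tendsto (fun n ↦ a n / (partitionScale n * saddle n ^ β : ℝ)) atTop (𝓝 c) := by
  have hline (x : ℝ) (hx : 0 < x) (z : ℂ) (hz : z.re = x) := ha z (hz ▸ hx)
  have hcont (x : ℝ) (hx : 0 < x) : Continuous (circleIntegrand F x) :=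
    (continuous_of_hasSum_mul_exp_neg_pow (hline x hx)).mul (by fun_prop)
  have hlim := ((tendsto_integral_circleIntegrand hcont hC hF).comp tendsto_saddle).const_mul
    ((π / √3 : ℝ) : ℂ)
  rw [← mul_assoc, ← ofReal_mul, div_mul_div_cancel₀' Real.pi_ne_zero, div_self (by positivity),
    ofReal_one, one_mul] at hlim
  refine hlim.congr' ?_
  filter_upwards [eventually_ne_atTop 0] with n hn
  have hn' : (n : ℂ) = π ^ 2 / (6 * saddle n ^ 2) := mod_cast natCast_eq_div_saddle_sq hn
  have hcoeff := integral_mul_exp_eq_two_pi_mul_coeff (hline _ (saddle_pos hn)) n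
  rw [hn'] at hcoeff
  have hsaddle : (saddle n : ℂ) ≠ 0 := ofReal_ne_zero.mpr (saddle_pos hn).ne'
  simp only [Function.comp_apply, circleIntegrand, hcoeff, partitionScale_eq hn]
  push_cast
  field_simp
  ring

end CircleMethod

/-! ### Strongly unimodal sequences as pairs of sets -/

lemma IsStronglyUnimodalOfRank.unique {a : List ℕ} {m l : ℤ} (hm : IsStronglyUnimodalOfRank a m)
    (hl : IsStronglyUnimodalOfRank a l) : m = l := by
  obtain ⟨k, hk, rfl⟩ := hm
  obtain ⟨k', hk', rfl⟩ := hl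
  rw [hk.unique hk']

lemma sum_sort {M : Type*} [AddCommMonoid M] (s : Finset M) (r : M → M → Prop) [DecidableRel r]
    [IsTrans M r] [Std.Antisymm r] [Std.Total r] : (s.sort r).sum = ∑ i ∈ s, i := by
  rw [← Multiset.sum_coe, Finset.sort_eq, Finset.sum_eq_multiset_sum, Multiset.map_id']

/-- A strongly unimodal sequence with peak `N + 1`, encoded by the sets of its terms before and
after the peak. -/
abbrev UnimodalData : Type :=
  Σ N : ℕ, ↥((Finset.Icc 1 N).powerset ×ˢ (Finset.Icc 1 N).powerset)

namespace UnimodalData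

/-- The set of terms before the peak. -/
def left (t : UnimodalData) : Finset ℕ := t.2.1.1

/-- The set of terms after the peak. -/
def right (t : UnimodalData) : Finset ℕ := t.2.1.2

/-- The sum of the terms. -/
def size (t : UnimodalData) : ℕ := t.1 + 1 + ∑ i ∈ t.left, i + ∑ i ∈ t.right, i

/-- The number of terms after the peak minus the number of terms before it. -/
def rank (t : UnimodalData) : ℤ := t.right.card - t.left.card

/-- The encoded sequence. -/
def toList (t : UnimodalData) : List ℕ :=
  t.left.sort (· ≤ ·) ++ (t.1 + 1) :: t.right.sort (· ≥ ·)

variable {t : UnimodalData} {i : ℕ}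

lemma mem_Icc_of_mem_left (hi : i ∈ t.left) : i ∈ Finset.Icc 1 t.1 :=
  Finset.mem_powerset.mp (Finset.mem_product.mp t.2.2).1 hi

lemma mem_Icc_of_mem_right (hi : i ∈ t.right) : i ∈ Finset.Icc 1 t.1 :=
  Finset.mem_powerset.mp (Finset.mem_product.mp t.2.2).2 hi

lemma lt_peak_of_mem_left (hi : i ∈ t.left) : i < t.1 + 1 :=
  Nat.lt_succ_of_le (Finset.mem_Icc.mp (mem_Icc_of_mem_left hi)).2

lemma lt_peak_of_mem_right (hi : i ∈ t.right) : i < t.1 + 1 :=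
  Nat.lt_succ_of_le (Finset.mem_Icc.mp (mem_Icc_of_mem_right hi)).2

lemma sum_toList (t : UnimodalData) : t.toList.sum = t.size := by
  rw [toList, List.sum_append, List.sum_cons, sum_sort, sum_sort, size]
  ring

lemma pos_of_mem_toList (hi : i ∈ t.toList) : 0 < i := by
  simp only [toList, List.mem_append, List.mem_cons, Finset.mem_sort] at hi
  rcases hi with hleft | rfl | hright
  · exact (Finset.mem_Icc.mp (mem_Icc_of_mem_left hleft)).1
  · exact t.1.succ_pos
  · exact (Finset.mem_Icc.mp (mem_Icc_of_mem_right hright)).1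

lemma isStronglyUnimodalAt_toList (t : UnimodalData) :
    IsStronglyUnimodalAt t.toList t.left.card := by
  have hlen : (t.left.sort (· ≤ ·)).length = t.left.card := Finset.length_sort _
  have htake : t.toList.take (t.left.card + 1) = t.left.sort (· ≤ ·) ++ [t.1 + 1] := by
    rw [toList, ← hlen, List.take_length_add_append, List.take_succ_cons, List.take_zero]
  refine ⟨by simp [toList], ?_, ?_⟩
  · rw [htake, List.pairwise_append]
    refine ⟨(Finset.sortedLT_sort _).pairwise, List.pairwise_singleton _ _, fun i hi j hj ↦ ?_⟩
    rw [List.mem_singleton.mp hj]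
    exact lt_peak_of_mem_left ((Finset.mem_sort _).mp hi)
  · rw [toList, List.drop_left' hlen, List.pairwise_cons]
    exact ⟨fun i hi ↦ lt_peak_of_mem_right ((Finset.mem_sort _).mp hi),
      (Finset.sortedGT_sort _).pairwise⟩

lemma isStronglyUnimodalOfRank_toList (t : UnimodalData) :
    IsStronglyUnimodalOfRank t.toList t.rank := by
  refine ⟨_, t.isStronglyUnimodalAt_toList, ?_⟩
  simp only [toList, rank, List.length_append, List.length_cons, Finset.length_sort]
  push_cast
  ring

lemma toList_injective : Function.Injective toList := by
  intro t t' h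
  have hcard : t.left.card = t'.left.card :=
    t.isStronglyUnimodalAt_toList.unique (h ▸ t'.isStronglyUnimodalAt_toList)
  obtain ⟨hsortl, htail⟩ := List.append_inj h (by simpa using hcard)
  obtain ⟨hpeak, hsortr⟩ := List.cons.inj htail
  have hleft : t.left = t'.left := by
    rw [← Finset.sort_toFinset t.left (· ≤ ·), hsortl, Finset.sort_toFinset]
  have hright : t.right = t'.right := by
    rw [← Finset.sort_toFinset t.right (· ≥ ·), hsortr, Finset.sort_toFinset]
  obtain ⟨N, ⟨⟨A, B⟩, hAB⟩⟩ := t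
  obtain ⟨N', ⟨⟨A', B'⟩, hAB'⟩⟩ := t'
  obtain rfl : N = N' := Nat.succ_injective hpeak
  obtain rfl : A = A' := hleft
  obtain rfl : B = B' := hright
  rfl

lemma exists_toList_eq {a : List ℕ} {k : ℕ} (hpos : ∀ i ∈ a, 0 < i)
    (ha : IsStronglyUnimodalAt a k) : ∃ t : UnimodalData, t.toList = a := by
  obtain ⟨hk, hinc, hdec⟩ := ha
  have hdrop : a.drop k = a[k] :: a.drop (k + 1) := List.drop_eq_getElem_cons hk
  rw [← List.take_concat_get' a k hk, List.pairwise_append] at hinc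
  rw [hdrop, List.pairwise_cons] at hdec
  have hleft : (a.take k).toFinset ⊆ Finset.Icc 1 (a[k] - 1) := fun i hi ↦ by
    have himem := List.mem_toFinset.mp hi
    exact Finset.mem_Icc.mpr ⟨hpos i (List.mem_of_mem_take himem),
      Nat.le_sub_one_of_lt (hinc.2.2 i himem a[k] (List.mem_singleton_self _))⟩
  have hright : (a.drop (k + 1)).toFinset ⊆ Finset.Icc 1 (a[k] - 1) := fun i hi ↦ by
    have himem := List.mem_toFinset.mp hi
    exact Finset.mem_Icc.mpr ⟨hpos i (List.mem_of_mem_drop himem),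
      Nat.le_sub_one_of_lt (hdec.1 i himem)⟩
  refine ⟨⟨a[k] - 1, ⟨((a.take k).toFinset, (a.drop (k + 1)).toFinset),
    Finset.mem_product.mpr ⟨Finset.mem_powerset.mpr hleft, Finset.mem_powerset.mpr hright⟩⟩⟩, ?_⟩
  have hsortl : (a.take k).toFinset.sort (· ≤ ·) = a.take k :=
    (List.toFinset_sort _ (hinc.1.imp fun h ↦ h.ne)).mpr (hinc.1.imp fun h ↦ h.le)
  have hsortr : (a.drop (k + 1)).toFinset.sort (· ≥ ·) = a.drop (k + 1) :=
    (List.toFinset_sort _ (hdec.2.imp fun h ↦ h.ne')).mpr (hdec.2.imp fun h ↦ h.le)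
  simp only [toList, left, right]
  rw [hsortl, hsortr, Nat.sub_add_cancel (hpos _ (List.getElem_mem hk)), ← hdrop,
    List.take_append_drop]

instance (n : ℕ) : Finite {t : UnimodalData // t.size = n} := by
  refine Finite.of_injective (fun t ↦ (⟨t.1.toList, pos_of_mem_toList,
    t.1.sum_toList.trans t.2⟩ : Composition n)) fun t t' h ↦ ?_
  exact Subtype.ext (toList_injective (congrArg Composition.blocks h))

/-- Reversal of the sequence. -/
def swap (t : UnimodalData) : UnimodalData :=
  ⟨t.1, t.2.1.swap, Finset.mem_product.mpr (Finset.mem_product.mp t.2.2).symm⟩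

lemma size_swap (t : UnimodalData) : t.swap.size = t.size := add_right_comm _ _ _

lemma rank_swap (t : UnimodalData) : t.swap.rank = -t.rank := (neg_sub _ _).symm

end UnimodalData

open UnimodalData

lemma unimodalCount_eq_card (m : ℤ) (n : ℕ) :
    unimodalCount m n = Nat.card {t : UnimodalData // t.size = n ∧ t.rank = m} := by
  refine (Nat.card_eq_of_bijective (fun t : {t : UnimodalData // t.size = n ∧ t.rank = m} ↦
    (⟨⟨t.1.toList, pos_of_mem_toList, t.1.sum_toList.trans t.2.1⟩,
      t.2.2.subst (motive := IsStronglyUnimodalOfRank _) t.1.isStronglyUnimodalOfRank_toList⟩ :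
      {c : Composition n // IsStronglyUnimodalOfRank c.blocks m})) ⟨fun t t' h ↦ ?_, ?_⟩).symm
  · exact Subtype.ext (toList_injective (congrArg (fun c ↦ c.1.blocks) h))
  · rintro ⟨c, hc⟩
    obtain ⟨k, hk, -⟩ := id hc
    obtain ⟨t, ht⟩ := exists_toList_eq (fun i hi ↦ c.blocks_pos hi) hk
    have hsize : t.size = n := by rw [← t.sum_toList, ht, c.blocks_sum]
    have hrank : t.rank = m := t.isStronglyUnimodalOfRank_toList.unique (ht ▸ hc)
    exact ⟨⟨t, hsize, hrank⟩, Subtype.ext (Composition.ext ht)⟩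

lemma unimodalCount_neg (m : ℤ) (n : ℕ) : unimodalCount (-m) n = unimodalCount m n := by
  rw [unimodalCount_eq_card, unimodalCount_eq_card]
  refine Nat.card_congr
    { toFun t := ⟨t.1.swap, t.1.size_swap.trans t.2.1, ?_⟩
      invFun t := ⟨t.1.swap, t.1.size_swap.trans t.2.1, ?_⟩
      left_inv _ := rfl
      right_inv _ := rfl }
  · rw [rank_swap, t.2.2, neg_neg]
  · rw [rank_swap, t.2.2]

/-! ### The `q`-binomial theorem -/

/-- The finite `q`-factorial `(q; q)_n = (1 - q) ⋯ (1 - q ^ n)`. -/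
def qFac {R : Type*} [CommRing R] (q : R) (n : ℕ) : R := ∏ i ∈ Finset.range n, (1 - q ^ (i + 1))

section QBinomial

open Polynomial

section CommRing

variable {R : Type*} [CommRing R] (q : R)

@[simp] lemma qFac_zero : qFac q 0 = 1 := rfl

lemma qFac_succ (n : ℕ) : qFac q (n + 1) = qFac q n * (1 - q ^ (n + 1)) :=
  Finset.prod_range_succ _ _

lemma qFac_add (n k : ℕ) :
    qFac q (n + k) = qFac q n * ∏ i ∈ Finset.range k, (1 - q ^ (n + i + 1)) :=
  Finset.prod_range_add _ _ _

lemma natDegree_prod_one_add_pow_mul_X_le (n : ℕ) :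
    (∏ i ∈ Finset.range n, (1 + C (q ^ i) * X)).natDegree ≤ n := by
  refine (natDegree_prod_le _ _).trans ((Finset.sum_le_card_nsmul _ _ 1 fun i _ ↦ ?_).trans
    (by simp))
  rw [add_comm, ← C_1]
  exact natDegree_linear_le

lemma coeff_prod_one_add_pow_mul_X_mul (k d : ℕ) :
    (∏ i ∈ Finset.range (k + d), (1 + C (q ^ i) * X)).coeff k * (qFac q k * qFac q d) =
      q ^ k.choose 2 * qFac q (k + d) := by
  induction h : k + d generalizing k d with
  | zero =>
    obtain ⟨rfl, rfl⟩ := Nat.add_eq_zero_iff.mp h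
    simp
  | succ n ih =>
    rw [Finset.prod_range_succ, mul_add, mul_one, coeff_add, mul_comm (C (q ^ n)),
      ← mul_assoc (∏ _ ∈ _, _), coeff_mul_C]
    rcases k with _ | k
    · obtain rfl : d = n + 1 := by omega
      have hzero := ih 0 n (zero_add n)
      simp only [qFac_zero, Nat.choose_zero_succ, pow_zero, one_mul] at hzero
      rw [mul_coeff_zero, coeff_X_zero, mul_zero, zero_mul, add_zero, qFac_zero, qFac_succ,
        Nat.choose_zero_succ, pow_zero, one_mul, ← mul_assoc, hzero]
    · rw [coeff_mul_X, Nat.choose_succ_succ' k 1, Nat.choose_one_right, pow_add, qFac_succ q n]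
      rcases d with _ | d
      · obtain rfl : k = n := by omega
        have htop := ih k 0 (add_zero k)
        rw [coeff_eq_zero_of_natDegree_lt
          (Nat.lt_succ_of_le (natDegree_prod_one_add_pow_mul_X_le q k)), qFac_succ]
        linear_combination q ^ k * (1 - q ^ (k + 1)) * htop
      · obtain rfl : n = k + 1 + d := by omega
        have hlow := ih k (d + 1) (by omega)
        have hhigh := ih (k + 1) d rfl
        rw [qFac_succ q d] at hlow
        rw [Nat.choose_succ_succ' k 1, Nat.choose_one_right, pow_add, qFac_succ q k] at hhigh
        rw [qFac_succ q k, qFac_succ q d]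
        linear_combination (1 - q ^ (d + 1)) * hhigh + q ^ (k + 1 + d) * (1 - q ^ (k + 1)) * hlow

/-- The generating polynomial `∑ q ^ (∑ A + ∑ B) X ^ (N + #B - #A)` of the pairs `A, B` of subsets
of `{1, …, N}`; the exponent of `X` is the rank shifted by `N`. -/
noncomputable def rankPoly (N : ℕ) : R[X] :=
  ∏ i ∈ Finset.Icc 1 N, ((1 + C (q ^ i) * X) * (X + C (q ^ i)))

lemma rankPoly_succ (N : ℕ) : rankPoly q (N + 1) =
    rankPoly q N * ((1 + C (q ^ (N + 1)) * X) * (X + C (q ^ (N + 1)))) :=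
  Finset.prod_Icc_succ_top (by omega) _

lemma prod_one_add_pow_mul_X_eq_sum (s : Finset ℕ) :
    ∏ i ∈ s, (1 + C (q ^ i) * X) = ∑ B ∈ s.powerset, C (q ^ ∑ i ∈ B, i) * X ^ B.card := by
  rw [Finset.prod_one_add]
  refine Finset.sum_congr rfl fun B _ ↦ ?_
  rw [Finset.prod_mul_distrib, Finset.prod_const, ← Finset.prod_pow_eq_pow_sum, map_prod]

lemma prod_X_add_pow_eq_sum (s : Finset ℕ) :
    ∏ i ∈ s, (X + C (q ^ i)) =
      ∑ A ∈ s.powerset, C (q ^ ∑ i ∈ A, i) * X ^ (s.card - A.card) := by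
  simp only [add_comm X]
  rw [Finset.prod_add]
  refine Finset.sum_congr rfl fun A hA ↦ ?_
  rw [Finset.prod_const, ← Finset.prod_pow_eq_pow_sum, map_prod,
    Finset.card_sdiff_of_subset (Finset.mem_powerset.mp hA)]

lemma coeff_rankPoly (N m : ℕ) :
    (rankPoly q N).coeff (N + m) =
      ∑ p ∈ (Finset.Icc 1 N).powerset ×ˢ (Finset.Icc 1 N).powerset,
        if (p.2.card : ℤ) - p.1.card = m then q ^ (∑ i ∈ p.1, i + ∑ i ∈ p.2, i) else 0 := by
  rw [rankPoly, Finset.prod_mul_distrib, prod_one_add_pow_mul_X_eq_sum, prod_X_add_pow_eq_sum,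
    mul_comm, Finset.sum_mul_sum, ← Finset.sum_product', finsetSum_coeff]
  refine Finset.sum_congr rfl fun p hp ↦ ?_
  have hcard : p.1.card ≤ N := by
    simpa using Finset.card_le_card (Finset.mem_powerset.mp (Finset.mem_product.mp hp).1)
  rw [mul_mul_mul_comm, ← C_mul, ← pow_add, ← pow_add, coeff_C_mul_X_pow, Nat.card_Icc]
  exact if_congr (by omega) rfl rfl

end CommRing

section Field

variable {K : Type*} [Field K] {q : K}

lemma prod_one_add_mul_pow (hq : ∀ n, qFac q n ≠ 0) (n : ℕ) (y : K) :
    ∏ i ∈ Finset.range n, (1 + y * q ^ i) = ∑ p ∈ Finset.HasAntidiagonal.antidiagonal n,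
      q ^ p.1.choose 2 * qFac q n / (qFac q p.1 * qFac q p.2) * y ^ p.1 := by
  have heval := eval_eq_sum_range'
    (Nat.lt_succ_of_le (natDegree_prod_one_add_pow_mul_X_le q n)) y
  simp only [eval_prod, eval_add, eval_one, eval_mul, eval_C, eval_X] at heval
  simp only [mul_comm y]
  refine heval.trans <| (Finset.Nat.sum_antidiagonal_eq_sum_range_succ_mk (fun p : ℕ × ℕ ↦
    (∏ i ∈ Finset.range n, (1 + C (q ^ i) * X)).coeff p.1 * y ^ p.1) n).symm.trans ?_
  refine Finset.sum_congr rfl fun p hp ↦ ?_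
  obtain rfl := Finset.HasAntidiagonal.mem_antidiagonal.mp hp
  rw [← coeff_prod_one_add_pow_mul_X_mul, mul_div_cancel_right₀ _ (mul_ne_zero (hq _) (hq _))]

lemma one_add_X_mul_rankPoly (hq0 : q ≠ 0) (N : ℕ) :
    (1 + X) * rankPoly q N = C (q ^ (N + 1).choose 2) *
      (∏ i ∈ Finset.range (2 * N + 1), (1 + C (q ^ i) * X)).comp (C (q⁻¹ ^ N) * X) := by
  simp only [prod_comp, add_comp, one_comp, mul_comp, C_comp, X_comp]
  induction N with
  | zero => simp [rankPoly]
  | succ N ih =>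
    have hshift (i : ℕ) : (C (q ^ (i + 1)) * (C (q⁻¹ ^ (N + 1)) * X) : K[X]) =
        C (q ^ i) * (C (q⁻¹ ^ N) * X) := by
      rw [← mul_assoc, ← C_mul, ← mul_assoc, ← C_mul, pow_succ, pow_succ, mul_mul_mul_comm,
        mul_inv_cancel₀ hq0, mul_one]
    have hlast : (C (q ^ (2 * N + 1 + 1)) * (C (q⁻¹ ^ (N + 1)) * X) : K[X]) =
        C (q ^ (N + 1)) * X := by
      rw [← mul_assoc, ← C_mul, show 2 * N + 1 + 1 = (N + 1) + (N + 1) by ring, pow_add, mul_assoc,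
        ← mul_pow, mul_inv_cancel₀ hq0, one_pow, mul_one]
    have hfirst : (C (q ^ (N + 1)) * (1 + C (q ^ 0) * (C (q⁻¹ ^ (N + 1)) * X)) : K[X]) =
        X + C (q ^ (N + 1)) := by
      rw [pow_zero, C_1, one_mul, mul_add, mul_one, ← mul_assoc, ← C_mul, ← mul_pow,
        mul_inv_cancel₀ hq0, one_pow, C_1, one_mul, add_comm]
    rw [rankPoly_succ, ← mul_assoc, ih, show 2 * (N + 1) + 1 = (2 * N + 1) + 1 + 1 by ring,
      Finset.prod_range_succ _ (2 * N + 1 + 1), Finset.prod_range_succ' _ (2 * N + 1), hlast,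
      ← hfirst, Nat.choose_succ_succ' (N + 1) 1,
      Nat.choose_one_right, pow_add q (N + 1), C_mul]
    simp only [hshift]
    ring

lemma succ_choose_two_add_choose_two (N m : ℕ) :
    (N + 1).choose 2 + (N + m).choose 2 = N * (N + m) + m.choose 2 := by
  qify
  simp only [Nat.cast_choose_two]
  push_cast
  ring

lemma coeff_one_add_X_mul_rankPoly (hq : ∀ n, qFac q n ≠ 0) (hq0 : q ≠ 0) {N m n : ℕ}
    (h : N + 1 = m + n) : ((1 + X) * rankPoly q N).coeff (N + m) =
      q ^ m.choose 2 * qFac q (2 * N + 1) / (qFac q (N + m) * qFac q n) := by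
  have hpow : q ^ (N + 1).choose 2 * q ^ (N + m).choose 2 * (q⁻¹ ^ N) ^ (N + m) =
      q ^ m.choose 2 := by
    rw [← pow_add, succ_choose_two_add_choose_two, ← pow_mul, inv_pow, pow_add]
    field_simp
  rw [one_add_X_mul_rankPoly hq0, coeff_C_mul, comp_C_mul_X_coeff,
    eq_div_iff (mul_ne_zero (hq _) (hq _)), ← hpow, show 2 * N + 1 = N + m + n by omega]
  linear_combination q ^ (N + 1).choose 2 * (q⁻¹ ^ N) ^ (N + m) *
    coeff_prod_one_add_pow_mul_X_mul q (N + m) n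

lemma coeff_one_add_X_mul_rankPoly_eq_zero (hq0 : q ≠ 0) {N m : ℕ} (h : N + 1 < m) :
    ((1 + X) * rankPoly q N).coeff (N + m) = 0 := by
  rw [one_add_X_mul_rankPoly hq0, coeff_C_mul, comp_C_mul_X_coeff, coeff_eq_zero_of_natDegree_lt
    ((natDegree_prod_one_add_pow_mul_X_le q _).trans_lt (by omega)), zero_mul, mul_zero]

end Field

end QBinomial

section Euler

variable {q : ℂ}

lemma qFac_ne_zero (hq : ‖q‖ < 1) (n : ℕ) : qFac q n ≠ 0 :=
  Finset.prod_ne_zero_iff.mpr fun i _ ↦ one_sub_pow_succ_ne_zero hq i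

lemma tendsto_qFac (hq : ‖q‖ < 1) : Tendsto (qFac q) atTop (𝓝 (eulerProd q)) :=
  (hasProd_eulerProd hq).tendsto_prod_nat

lemma exists_norm_inv_qFac_le (hq : ‖q‖ < 1) : ∃ M, 0 ≤ M ∧ ∀ n, ‖(qFac q n)⁻¹‖ ≤ M := by
  obtain ⟨M, hM⟩ := ((tendsto_qFac hq).inv₀ (eulerProd_ne_zero hq)).norm.bddAbove_range
  exact ⟨M, (norm_nonneg _).trans (hM ⟨0, rfl⟩), fun n ↦ hM ⟨n, rfl⟩⟩

lemma summable_pow_div_qFac (hq : ‖q‖ < 1) {x : ℂ} (hx : ‖x‖ < 1) :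
    Summable fun l ↦ x ^ l / qFac q l := by
  obtain ⟨M, -, hM⟩ := exists_norm_inv_qFac_le hq
  refine .of_norm_bounded ((summable_geometric_of_lt_one (norm_nonneg x) hx).mul_right M)
    fun l ↦ ?_
  rw [div_eq_mul_inv, norm_mul, norm_pow]
  gcongr
  exact hM l

lemma tsum_mul_pow_div_qFac (hq : ‖q‖ < 1) {x : ℂ} (hx : ‖x‖ < 1) :
    ∑' l, (q * x) ^ l / qFac q l = (1 - x) * ∑' l, x ^ l / qFac q l := by
  have hqx : ‖q * x‖ < 1 := by
    rw [norm_mul]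
    exact mul_lt_one_of_nonneg_of_lt_one_left (norm_nonneg q) hq hx.le
  have hs := summable_pow_div_qFac hq hx
  have hdiff : ∑' l, x ^ l / qFac q l - ∑' l, (q * x) ^ l / qFac q l =
      x * ∑' l, x ^ l / qFac q l := by
    rw [← hs.tsum_sub (summable_pow_div_qFac hq hqx), ← tsum_mul_left,
      (hs.sub (summable_pow_div_qFac hq hqx)).tsum_eq_zero_add]
    simp only [pow_zero, sub_self, zero_add]
    refine tsum_congr fun l ↦ ?_
    rw [qFac_succ, ← sub_div, mul_pow, ← one_sub_mul, mul_comm (1 - _),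
      mul_div_mul_right _ _ (one_sub_pow_succ_ne_zero hq l), pow_succ', mul_div_assoc]
  linear_combination -hdiff

lemma tsum_pow_succ_pow_div_qFac (hq : ‖q‖ < 1) (k : ℕ) :
    ∑' l, (q ^ (k + 1)) ^ l / qFac q l = qFac q k * ∑' l, q ^ l / qFac q l := by
  induction k with
  | zero => simp
  | succ k ih =>
    rw [pow_succ' q (k + 1), tsum_mul_pow_div_qFac hq (norm_pow_succ_lt_one hq k), ih, qFac_succ]
    ring

lemma tendsto_tsum_pow_succ_pow_div_qFac (hq : ‖q‖ < 1) :
    Tendsto (fun k ↦ ∑' l, (q ^ (k + 1)) ^ l / qFac q l) atTop (𝓝 1) := by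
  have hlim : (1 : ℂ) = ∑' l : ℕ, if l = 0 then 1 else 0 := by simp
  rw [hlim]
  refine tendsto_tsum_of_dominated_convergence (summable_pow_div_qFac hq hq).norm (fun l ↦ ?_)
    (.of_forall fun k l ↦ ?_)
  · rcases l with _ | l
    · simp
    · have hpow : Tendsto (fun k ↦ q ^ (k + 1)) atTop (𝓝 0) :=
        (tendsto_pow_atTop_nhds_zero_of_norm_lt_one hq).comp (tendsto_add_atTop_nat 1)
      simpa using (hpow.pow (l + 1)).div_const (qFac q (l + 1))
  · rw [norm_div, norm_div, norm_pow, norm_pow q l]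
    gcongr
    exact (norm_pow q _).trans_le <|
      pow_le_of_le_one (norm_nonneg q) hq.le k.succ_ne_zero

/-- **Euler's identity** `∑ x ^ l / (q; q)_l = 1 / (x; q)_∞` at `x = q ^ (k + 1)`. -/
lemma hasSum_pow_succ_pow_div_qFac (hq : ‖q‖ < 1) (k : ℕ) :
    HasSum (fun l ↦ (q ^ (k + 1)) ^ l / qFac q l) (qFac q k / eulerProd q) := by
  have hone : eulerProd q * ∑' l, q ^ l / qFac q l = 1 :=
    tendsto_nhds_unique ((tendsto_qFac hq).mul_const _)
      ((tendsto_tsum_pow_succ_pow_div_qFac hq).congr (tsum_pow_succ_pow_div_qFac hq))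
  rw [div_eq_mul_inv, ← eq_inv_of_mul_eq_one_right hone, ← tsum_pow_succ_pow_div_qFac hq]
  exact (summable_pow_div_qFac hq (norm_pow_succ_lt_one hq k)).hasSum

end Euler

/-! ### Generating functions by rank -/

lemma prod_one_add_pow_le {r : ℝ} (h0 : 0 ≤ r) (h1 : r < 1) (s : Finset ℕ) :
    ∏ i ∈ s, (1 + r ^ i) ≤ Real.exp (1 - r)⁻¹ :=
  calc ∏ i ∈ s, (1 + r ^ i) ≤ ∏ i ∈ s, Real.exp (r ^ i) :=
        Finset.prod_le_prod (fun i _ ↦ by positivity) fun i _ ↦ by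
          linarith [Real.add_one_le_exp (r ^ i)]
    _ = Real.exp (∑ i ∈ s, r ^ i) := (Real.exp_sum _ _).symm
    _ ≤ _ := by
      rw [Real.exp_le_exp, ← tsum_geometric_of_lt_one h0 h1]
      exact (summable_geometric_of_lt_one h0 h1).sum_le_tsum _ fun i _ ↦ by positivity

lemma sum_pow_size {R : Type*} [CommSemiring R] (r : R) (N : ℕ) :
    ∑ p : ↥((Finset.Icc 1 N).powerset ×ˢ (Finset.Icc 1 N).powerset),
      r ^ size ⟨N, p⟩ = r ^ (N + 1) * (∏ i ∈ Finset.Icc 1 N, (1 + r ^ i)) ^ 2 := by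
  refine (Finset.sum_coe_sort ((Finset.Icc 1 N).powerset ×ˢ (Finset.Icc 1 N).powerset)
    fun p ↦ r ^ (N + 1 + ∑ i ∈ p.1, i + ∑ i ∈ p.2, i)).trans ?_
  rw [Finset.prod_one_add, sq, Finset.sum_mul_sum, ← Finset.sum_product', Finset.mul_sum]
  refine Finset.sum_congr rfl fun p _ ↦ ?_
  rw [Finset.prod_pow_eq_pow_sum, Finset.prod_pow_eq_pow_sum, pow_add, pow_add, mul_assoc]

lemma summable_pow_size {r : ℝ} (h0 : 0 ≤ r) (h1 : r < 1) :
    Summable fun t : UnimodalData ↦ r ^ t.size := by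
  rw [summable_sigma_of_nonneg fun t ↦ by positivity]
  refine ⟨fun N ↦ (hasSum_fintype _).summable, ?_⟩
  simp only [tsum_fintype]
  refine Summable.of_nonneg_of_le (fun N ↦ Finset.sum_nonneg fun p _ ↦ by positivity) (fun N ↦ ?_)
    (((summable_nat_add_iff 1).mpr (summable_geometric_of_lt_one h0 h1)).mul_right
      (Real.exp (1 - r)⁻¹ ^ 2))
  rw [sum_pow_size]
  gcongr
  exact prod_one_add_pow_le h0 h1 _

/-- The generating function of the strongly unimodal sequences of rank `m`. -/
noncomputable def rankGen (m : ℤ) (q : ℂ) : ℂ :=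
  ∑' t : UnimodalData, if t.rank = m then q ^ t.size else 0

section RankGen

variable {q : ℂ}

lemma norm_ite_rank_le (m : ℤ) (q : ℂ) (t : UnimodalData) :
    ‖if t.rank = m then q ^ t.size else 0‖ ≤ ‖q‖ ^ t.size := by
  split_ifs
  · rw [norm_pow]
  · rw [norm_zero]
    positivity

lemma hasSum_rankGen (m : ℤ) (hq : ‖q‖ < 1) :
    HasSum (fun t : UnimodalData ↦ if t.rank = m then q ^ t.size else 0) (rankGen m q) :=
  (Summable.of_norm_bounded (summable_pow_size (norm_nonneg q) hq) (norm_ite_rank_le m q)).hasSum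

lemma hasSum_unimodalCount (m : ℤ) (hq : ‖q‖ < 1) :
    HasSum (fun n ↦ (unimodalCount m n : ℂ) * q ^ n) (rankGen m q) := by
  refine ((Equiv.sigmaFiberEquiv size).hasSum_iff.mpr (hasSum_rankGen m hq)).sigma fun n ↦ ?_
  classical
  have := Fintype.ofFinite {t : UnimodalData // t.size = n}
  have hsum : ∑ t : {t : UnimodalData // t.size = n}, (if t.1.rank = m then q ^ t.1.size else 0) =
      unimodalCount m n * q ^ n := by
    simp only [show ∀ t : {t : UnimodalData // t.size = n}, t.1.size = n from Subtype.property]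
    rw [← Finset.sum_filter, Finset.sum_const, nsmul_eq_mul, unimodalCount_eq_card,
      ← Fintype.card_subtype, ← Nat.card_eq_fintype_card]
    congr 2
    exact Nat.card_congr (Equiv.subtypeSubtypeEquivSubtypeInter
      (fun t : UnimodalData ↦ t.size = n) fun t ↦ t.rank = m)
  rw [← hsum]
  exact hasSum_fintype _

lemma tendsto_rankGen (hq : ‖q‖ < 1) : Tendsto (fun m : ℕ ↦ rankGen m q) atTop (𝓝 0) := by
  have hlim (t : UnimodalData) :
      Tendsto (fun m : ℕ ↦ if t.rank = m then q ^ t.size else 0) atTop (𝓝 0) := by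
    refine tendsto_const_nhds.congr' ?_
    filter_upwards [eventually_gt_atTop t.rank.toNat] with m hm
    rw [if_neg (by omega)]
  simpa [rankGen] using tendsto_tsum_of_dominated_convergence
    (summable_pow_size (norm_nonneg q) hq) hlim (.of_forall fun m t ↦ norm_ite_rank_le m q t)

lemma hasSum_coeff_rankPoly (m : ℕ) (hq : ‖q‖ < 1) :
    HasSum (fun N ↦ q ^ (N + 1) * (rankPoly q N).coeff (N + m)) (rankGen m q) := by
  refine (hasSum_rankGen m hq).sigma fun N ↦ ?_
  convert hasSum_fintype _ using 1
  refine Eq.trans ?_ (Finset.sum_coe_sort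
    ((Finset.Icc 1 N).powerset ×ˢ (Finset.Icc 1 N).powerset) fun p ↦
      if (p.2.card : ℤ) - p.1.card = m then q ^ (N + 1 + ∑ i ∈ p.1, i + ∑ i ∈ p.2, i) else 0).symm
  rw [coeff_rankPoly, Finset.mul_sum]
  refine Finset.sum_congr rfl fun p _ ↦ ?_
  rw [mul_ite, mul_zero, ← pow_add, add_assoc (N + 1)]

lemma hasSum_rankGen_add_rankGen (μ : ℕ) (hq : ‖q‖ < 1) (hq0 : q ≠ 0) :
    HasSum (fun n ↦ q ^ (n + μ + 1) * (q ^ (μ + 1).choose 2 * qFac q (2 * (n + μ) + 1) /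
      (qFac q (n + μ + (μ + 1)) * qFac q n))) (rankGen μ q + rankGen (μ + 1 : ℕ) q) := by
  have hadd : HasSum (fun N ↦ q ^ (N + 1) *
      ((1 + Polynomial.X) * rankPoly q N).coeff (N + (μ + 1)))
      (rankGen μ q + rankGen (μ + 1 : ℕ) q) := by
    refine ((hasSum_coeff_rankPoly μ hq).add (hasSum_coeff_rankPoly (μ + 1) hq)).congr_fun
      fun N ↦ ?_
    rw [add_mul, one_mul, Polynomial.coeff_add, ← add_assoc, Polynomial.coeff_X_mul]
    ring
  have hshift := (hasSum_nat_add_iff' μ).mpr hadd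
  rw [Finset.sum_eq_zero fun N hN ↦ by
    rw [coeff_one_add_X_mul_rankPoly_eq_zero hq0
      (Nat.succ_lt_succ (Finset.mem_range.mp hN)), mul_zero], sub_zero] at hshift
  refine hshift.congr_fun fun n ↦ ?_
  rw [coeff_one_add_X_mul_rankPoly (qFac_ne_zero hq) hq0 (n := n) (by omega)]

/-- The exponent `(k + μ + 1) (3 k + μ + 2) / 2`, in the form produced by the `q`-binomial
theorem. -/
def rankExponent (μ k : ℕ) : ℕ := (μ + 2).choose 2 + k.choose 2 + k * (k + 2 * μ + 2) + k

lemma cast_rankExponent (μ k : ℕ) : (rankExponent μ k : ℂ) = thetaExponent (μ + 1 : ℕ) k := by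
  simp only [rankExponent, thetaExponent]
  push_cast [Nat.cast_choose_two]
  ring

/-- The general term of the double series for `rankGen μ q + rankGen (μ + 1) q` that results from
expanding `(q; q)_{2 N + 1} / (q; q)_{N + μ + 1}` by the `q`-binomial theorem. -/
noncomputable def rankDoubleTerm (μ : ℕ) (q : ℂ) (p : ℕ × ℕ) : ℂ :=
  (-1) ^ p.1 * q ^ (rankExponent μ p.1 + (p.1 + 1) * p.2) / (qFac q p.1 * qFac q p.2)

lemma summable_rankDoubleTerm (μ : ℕ) (hq : ‖q‖ < 1) : Summable (rankDoubleTerm μ q) := by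
  obtain ⟨M, hM0, hM⟩ := exists_norm_inv_qFac_le hq
  have hgeo := summable_geometric_of_lt_one (norm_nonneg q) hq
  refine Summable.of_norm_bounded
    ((hgeo.mul_of_nonneg hgeo (fun _ ↦ by positivity) fun _ ↦ by positivity).mul_left (M * M))
    fun p ↦ ?_
  rw [rankDoubleTerm, div_eq_mul_inv, mul_inv, norm_mul, norm_mul, norm_mul, norm_pow, norm_pow,
    norm_neg, norm_one, one_pow, one_mul, mul_comm, ← pow_add]
  gcongr ?_ * ?_ * ?_
  · exact hM _
  · exact hM _
  · exact pow_le_pow_of_le_one (norm_nonneg _) hq.le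
      (by rw [rankExponent, add_one_mul]; omega)

lemma sum_antidiagonal_rankDoubleTerm (μ : ℕ) (hq : ‖q‖ < 1) (n : ℕ) :
    ∑ p ∈ Finset.HasAntidiagonal.antidiagonal n, rankDoubleTerm μ q p =
      q ^ (n + μ + 1) * (q ^ (μ + 1).choose 2 * qFac q (2 * (n + μ) + 1) /
        (qFac q (n + μ + (μ + 1)) * qFac q n)) := by
  have hsplit : qFac q (2 * (n + μ) + 1) = qFac q (n + μ + (μ + 1)) *
      ∏ i ∈ Finset.range n, (1 + -q ^ (n + 2 * μ + 2) * q ^ i) := by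
    rw [show 2 * (n + μ) + 1 = n + μ + (μ + 1) + n by ring, qFac_add]
    congr! 2 with i
    ring
  rw [hsplit, prod_one_add_mul_pow (qFac_ne_zero hq), mul_div_assoc,
    mul_div_mul_left _ _ (qFac_ne_zero hq _), Finset.sum_div, Finset.mul_sum, Finset.mul_sum]
  refine Finset.sum_congr rfl fun p hp ↦ ?_
  obtain rfl := Finset.HasAntidiagonal.mem_antidiagonal.mp hp
  have h₁ := qFac_ne_zero hq p.1
  have h₂ := qFac_ne_zero hq p.2
  have h₃ := qFac_ne_zero hq (p.1 + p.2)
  rw [rankDoubleTerm, rankExponent, Nat.choose_succ_succ' (μ + 1) 1, Nat.choose_one_right,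
    neg_pow (q ^ _), ← pow_mul]
  field_simp
  ring

lemma hasSum_rankDoubleTerm (μ : ℕ) (hq : ‖q‖ < 1) (hq0 : q ≠ 0) :
    HasSum (rankDoubleTerm μ q) (rankGen μ q + rankGen (μ + 1 : ℕ) q) := by
  have hsum := (summable_rankDoubleTerm μ hq).hasSum
  have hdiag : HasSum (fun n ↦ ∑ p ∈ Finset.HasAntidiagonal.antidiagonal n, rankDoubleTerm μ q p)
      (∑' p, rankDoubleTerm μ q p) := by
    refine (Finset.HasAntidiagonal.sigmaAntidiagonalEquivProd.hasSum_iff.mpr hsum).sigma fun n ↦ ?_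
    rw [← Finset.sum_coe_sort]
    exact hasSum_fintype _
  simp only [sum_antidiagonal_rankDoubleTerm μ hq] at hdiag
  rwa [hdiag.unique (hasSum_rankGen_add_rankGen μ hq hq0)] at hsum

lemma hasSum_rankDoubleTerm_right (μ : ℕ) (hq : ‖q‖ < 1) (k : ℕ) :
    HasSum (fun l ↦ rankDoubleTerm μ q (k, l))
      ((-1) ^ k * q ^ rankExponent μ k / eulerProd q) := by
  have h := (hasSum_pow_succ_pow_div_qFac hq k).mul_left
    ((-1) ^ k * q ^ rankExponent μ k / qFac q k)
  rw [div_mul_div_cancel₀ (qFac_ne_zero hq k)] at h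
  refine h.congr_fun fun l ↦ ?_
  rw [rankDoubleTerm, div_mul_div_comm, pow_add, ← pow_mul, mul_assoc]

/-- The generating function of the strongly unimodal sequences of rank `m`, with the partition
generating function `1 / (q; q)_∞` divided out. -/
noncomputable def reducedGen (m : ℕ) (q : ℂ) : ℂ := eulerProd q * rankGen m q

lemma rankGen_eq_reducedGen_div (m : ℕ) (hq : ‖q‖ < 1) :
    rankGen m q = reducedGen m q / eulerProd q :=
  (mul_div_cancel_left₀ _ (eulerProd_ne_zero hq)).symm

lemma hasSum_reducedGen_add_reducedGen (μ : ℕ) (hq : ‖q‖ < 1) (hq0 : q ≠ 0) :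
    HasSum (fun k : ℕ ↦ (-1) ^ k * q ^ rankExponent μ k)
      (reducedGen μ q + reducedGen (μ + 1) q) := by
  have h := ((hasSum_rankDoubleTerm μ hq hq0).prod_fiberwise
    (hasSum_rankDoubleTerm_right μ hq)).mul_left (eulerProd q)
  rw [mul_add] at h
  exact h.congr_fun fun k ↦ (mul_div_cancel₀ _ (eulerProd_ne_zero hq)).symm

lemma tendsto_reducedGen (m : ℕ) (hq : ‖q‖ < 1) :
    Tendsto (fun j : ℕ ↦ reducedGen (m + j) q) atTop (𝓝 0) := by
  have h := ((tendsto_rankGen hq).const_mul (eulerProd q)).comp (tendsto_add_atTop_nat m)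
  rw [mul_zero] at h
  refine h.congr fun j ↦ ?_
  rw [Function.comp_apply, reducedGen, add_comm j m]

lemma norm_reducedGen_add_reducedGen_le (m : ℕ) (hq : ‖q‖ < 1) (hq0 : q ≠ 0) :
    ‖reducedGen m q + reducedGen (m + 1) q‖ ≤ ‖q‖ ^ m * (1 - ‖q‖)⁻¹ := by
  rw [← (hasSum_reducedGen_add_reducedGen m hq hq0).tsum_eq]
  refine tsum_of_norm_bounded ((hasSum_geometric_of_lt_one (norm_nonneg q) hq).mul_left _)
    fun k ↦ ?_
  rw [norm_mul, norm_pow, norm_neg, norm_one, one_pow, one_mul, norm_pow, ← pow_add]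
  refine pow_le_pow_of_le_one (norm_nonneg _) hq.le ?_
  rw [rankExponent, Nat.choose_succ_succ' (m + 1) 1, Nat.choose_one_right]
  omega

lemma norm_reducedGen_le (m : ℕ) (hq : ‖q‖ < 1) (hq0 : q ≠ 0) :
    ‖reducedGen m q‖ ≤ (1 - ‖q‖)⁻¹ ^ 2 := by
  have hbound (j : ℕ) : ‖reducedGen (m + j) q + reducedGen (m + (j + 1)) q‖ ≤
      ‖q‖ ^ j * (1 - ‖q‖)⁻¹ := by
    refine (norm_reducedGen_add_reducedGen_le (m + j) hq hq0).trans ?_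
    exact mul_le_mul_of_nonneg_right
      (pow_le_pow_of_le_one (norm_nonneg _) hq.le (Nat.le_add_left j m))
      (inv_nonneg.mpr (sub_nonneg.mpr hq.le))
  have hgeo := (hasSum_geometric_of_lt_one (norm_nonneg q) hq).mul_right (1 - ‖q‖)⁻¹
  have hsum := Summable.of_nonneg_of_le (fun _ ↦ norm_nonneg _) hbound hgeo.summable
  calc ‖reducedGen m q‖ ≤ ∑' j, ‖reducedGen (m + j) q + reducedGen (m + (j + 1)) q‖ :=
        norm_le_tsum_of_add_succ (fun _ ↦ rfl) (tendsto_reducedGen m hq) hsum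
    _ ≤ ∑' j, ‖q‖ ^ j * (1 - ‖q‖)⁻¹ := hsum.tsum_le_tsum hbound hgeo.summable
    _ = (1 - ‖q‖)⁻¹ ^ 2 := by rw [hgeo.tsum_eq, sq]

end RankGen

section ReducedGenExp

variable {z : ℂ}

lemma reducedGen_add_reducedGen_exp (μ : ℕ) (hz : 0 < z.re) :
    reducedGen μ (exp (-z)) + reducedGen (μ + 1) (exp (-z)) = partialTheta z (μ + 1) := by
  rw [partialTheta, ← (hasSum_reducedGen_add_reducedGen μ (norm_exp_neg_lt_one hz)
    (exp_ne_zero _)).tsum_eq]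
  refine tsum_congr fun k ↦ ?_
  rw [thetaTerm, ← exp_nat_mul, cast_rankExponent, real_smul, mul_comm (-z)]
  push_cast
  rfl

lemma norm_reducedGen_exp_le (m : ℕ) (hz : 0 < z.re) (hz1 : z.re ≤ 1) :
    ‖reducedGen m (exp (-z))‖ ≤ 4 / z.re ^ 2 := by
  refine (norm_reducedGen_le m (norm_exp_neg_lt_one hz) (exp_ne_zero _)).trans ?_
  have hinv : 0 ≤ (1 - Real.exp (-z.re))⁻¹ :=
    inv_nonneg.mpr (sub_nonneg.mpr (Real.exp_le_one_iff.mpr (neg_nonpos.mpr hz.le)))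
  calc (1 - ‖exp (-z)‖)⁻¹ ^ 2 = (1 - Real.exp (-z.re))⁻¹ ^ 2 := by rw [norm_exp, neg_re]
    _ ≤ (2 / z.re) ^ 2 := by
      gcongr
      exact inv_one_sub_exp_neg_le hz hz1
    _ = 4 / z.re ^ 2 := by ring

end ReducedGenExp

lemma reducedGen_sub_isLittleO (m : ℕ) :
    (fun z ↦ reducedGen m (exp (-z)) - (1 / 4 - z * linearCoeff (m + 1))) =o[coneFilter]
      fun z : ℂ ↦ z := by
  refine sub_linear_isLittleO (m + 1) (S := fun z j ↦ reducedGen (m + j) (exp (-z)))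
    (fun z hz j ↦ ?_) fun z hz ↦ tendsto_reducedGen m (norm_exp_neg_lt_one hz)
  rw [← add_assoc, reducedGen_add_reducedGen_exp _ hz, add_right_comm]

/-! ### Asymptotics -/

lemma tendsto_reducedGen_exp (m : ℕ) :
    Tendsto (fun z ↦ reducedGen m (exp (-z))) coneFilter (𝓝 (1 / 4)) := by
  have hlinear : Tendsto (fun z : ℂ ↦ 1 / 4 - z * linearCoeff (m + 1)) coneFilter (𝓝 (1 / 4)) := by
    simpa using tendsto_const_nhds.sub (tendsto_id_coneFilter.mul_const (linearCoeff (m + 1)))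
  simpa using ((reducedGen_sub_isLittleO m).trans_tendsto tendsto_id_coneFilter).add hlinear

lemma tendsto_reducedGen_sub_div (m : ℕ) :
    Tendsto (fun z ↦ (reducedGen m (exp (-z)) - reducedGen (m + 1) (exp (-z))) / z) coneFilter
      (𝓝 ((2 * m + 1) / 8)) := by
  have h := ((reducedGen_sub_isLittleO m).sub
    (reducedGen_sub_isLittleO (m + 1))).tendsto_div_nhds_zero.add_const ((2 * m + 1 : ℂ) / 8)
  rw [zero_add] at h
  refine h.congr' ?_
  filter_upwards [eventually_coneFilter_mem] with z hz
  have hz0 : z ≠ 0 := by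
    rintro rfl
    simp at hz
  rw [← linearCoeff_succ_sub]
  field_simp
  ring

lemma tendsto_unimodalCount_natCast_div (m : ℕ) :
    Tendsto (fun n ↦ (unimodalCount m n : ℝ) / partitionScale n) atTop (𝓝 (1 / 4)) := by
  have h := tendsto_coeff_div (β := 0)
    (fun z hz ↦ rankGen_eq_reducedGen_div m (norm_exp_neg_lt_one hz) ▸
      hasSum_unimodalCount m (norm_exp_neg_lt_one hz))
    (fun z ↦ norm_reducedGen_exp_le m) (by simpa using tendsto_reducedGen_exp m)
  rw [← tendsto_ofReal_iff]
  simpa using h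

lemma tendsto_unimodalCount_natCast_sub_div (m : ℕ) :
    Tendsto (fun n ↦ ((unimodalCount m n : ℝ) - unimodalCount (m + 1) n) /
      (partitionScale n * saddle n)) atTop (𝓝 ((2 * m + 1) / 8)) := by
  have hsum (z : ℂ) (hz : 0 < z.re) :
      HasSum (fun n ↦ ((unimodalCount m n : ℂ) - unimodalCount (m + 1 : ℕ) n) * exp (-z) ^ n)
        ((reducedGen m (exp (-z)) - reducedGen (m + 1) (exp (-z))) / eulerProd (exp (-z))) := by
    have hq := norm_exp_neg_lt_one hz
    rw [sub_div, ← rankGen_eq_reducedGen_div m hq, ← rankGen_eq_reducedGen_div (m + 1) hq]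
    simpa only [sub_mul] using
      (hasSum_unimodalCount m hq).sub (hasSum_unimodalCount (m + 1 : ℕ) hq)
  have hbound (z : ℂ) (hz : 0 < z.re) (hz1 : z.re ≤ 1) :
      ‖reducedGen m (exp (-z)) - reducedGen (m + 1) (exp (-z))‖ ≤ 8 / z.re ^ 2 :=
    calc _ ≤ 4 / z.re ^ 2 + 4 / z.re ^ 2 := (norm_sub_le _ _).trans <|
          add_le_add (norm_reducedGen_exp_le m hz hz1) (norm_reducedGen_exp_le (m + 1) hz hz1)
      _ = _ := by ring
  have h := tendsto_coeff_div (β := 1) hsum hbound (by simpa using tendsto_reducedGen_sub_div m)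
  rw [← tendsto_ofReal_iff]
  simpa using h

lemma tendsto_unimodalCount_div (m : ℤ) :
    Tendsto (fun n ↦ (unimodalCount m n : ℝ) / partitionScale n) atTop (𝓝 (1 / 4)) := by
  obtain ⟨k, rfl | rfl⟩ := m.eq_nat_or_neg
  · exact tendsto_unimodalCount_natCast_div k
  · simpa only [unimodalCount_neg] using tendsto_unimodalCount_natCast_div k

lemma tendsto_unimodalCount_sub_div (m : ℤ) :
    Tendsto (fun n ↦ ((unimodalCount m n : ℝ) - unimodalCount (m + 1) n) /
      (partitionScale n * saddle n)) atTop (𝓝 ((2 * m + 1) / 8)) := by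
  rcases m with k | k
  · simpa using tendsto_unimodalCount_natCast_sub_div k
  · have hlim : (2 * (Int.negSucc k : ℝ) + 1) / 8 = -((2 * k + 1) / 8) := by
      push_cast [Int.negSucc_eq]
      ring
    rw [hlim]
    refine (tendsto_unimodalCount_natCast_sub_div k).neg.congr fun n ↦ ?_
    rw [Int.negSucc_eq, neg_add_rev, neg_add_cancel_comm, ← neg_add_rev, unimodalCount_neg,
      unimodalCount_neg, ← neg_div, neg_sub]

lemma tendsto_unimodalCount_sq_sub_div (m : ℤ) :
    Tendsto (fun n ↦ ((unimodalCount m n : ℝ) ^ 2 -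
      unimodalCount (m - 1) n * unimodalCount (m + 1) n) /
      (partitionScale n ^ 2 * saddle n)) atTop (𝓝 (1 / 16)) := by
  have hcount := tendsto_unimodalCount_div m
  have hright := tendsto_unimodalCount_sub_div m
  have hleft := tendsto_unimodalCount_sub_div (m - 1)
  rw [sub_add_cancel] at hleft
  have hsaddle : Tendsto saddle atTop (𝓝 0) := tendsto_saddle.mono_right nhdsWithin_le_nhds
  have h := (hcount.mul (hright.sub hleft)).add ((hright.mul hleft).mul hsaddle)
  have hlim : 1 / 4 * ((2 * (m : ℝ) + 1) / 8 - (2 * ((m - 1 : ℤ) : ℝ) + 1) / 8) +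
      (2 * (m : ℝ) + 1) / 8 * ((2 * ((m - 1 : ℤ) : ℝ) + 1) / 8) * 0 = 1 / 16 := by
    push_cast
    ring
  rw [hlim] at h
  refine h.congr' ?_
  filter_upwards [eventually_ne_atTop 0] with n hn
  have hs := (saddle_pos hn).ne'
  have hp := (partitionScale_pos hn).ne'
  field_simp
  ring

lemma isEquivalent_const_mul_of_tendsto_div {α 𝕜 : Type*} [NormedField 𝕜] {l : Filter α}
    {f g : α → 𝕜} {c : 𝕜} (hc : c ≠ 0) (h : Tendsto (fun x ↦ f x / g x) l (𝓝 c)) :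
    Asymptotics.IsEquivalent l f fun x ↦ c * g x := by
  refine Asymptotics.isEquivalent_of_tendsto_one ?_
  simpa [Pi.div_def, div_mul_eq_div_div_swap, hc] using h.div_const c

lemma const_mul_partitionScale (n : ℕ) :
    1 / 4 * partitionScale n = 1 / (16 * √3 * n) * Real.exp (π * √(2 * n / 3)) := by
  rw [partitionScale]
  ring

lemma const_mul_partitionScale_mul_saddle (c : ℝ) (n : ℕ) :
    c / 8 * (partitionScale n * saddle n) =
      π * c / (96 * √2 * n ^ (3 / 2 : ℝ)) * Real.exp (π * √(2 * n / 3)) := by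
  have hrpow : (n : ℝ) ^ (3 / 2 : ℝ) = n * √n := by
    rw [Real.sqrt_eq_rpow, ← Real.rpow_one_add' n.cast_nonneg (by norm_num)]
    norm_num
  have hsqrt : √(6 * n) = √2 * √3 * √n := by
    rw [← Real.sqrt_mul (by norm_num), ← Real.sqrt_mul (by norm_num)]
    norm_num
  have hthree : √3 * √3 = 3 := Real.mul_self_sqrt (by norm_num)
  rw [partitionScale, saddle, hrpow, hsqrt, show (96 : ℝ) = 32 * (√3 * √3) by rw [hthree]; norm_num]
  ring

lemma const_mul_partitionScale_sq_mul_saddle (n : ℕ) :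
    1 / 16 * (partitionScale n ^ 2 * saddle n) =
      π / (768 * √6 * n ^ (5 / 2 : ℝ)) * Real.exp (2 * π * √(2 * n / 3)) := by
  have hrpow : (n : ℝ) ^ (5 / 2 : ℝ) = n ^ 2 * √n := by
    rw [Real.sqrt_eq_rpow, ← Real.rpow_natCast, ← Real.rpow_add' n.cast_nonneg (by norm_num)]
    norm_num
  have hthree : √3 * √3 = 3 := Real.mul_self_sqrt (by norm_num)
  have hexp : Real.exp (2 * π * √(2 * n / 3)) = Real.exp (π * √(2 * n / 3)) ^ 2 := by
    rw [← Real.exp_nat_mul, Nat.cast_ofNat, mul_assoc]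
  rw [partitionScale, saddle, hrpow, hexp, Real.sqrt_mul (by norm_num),
    show (768 : ℝ) = 256 * (√3 * √3) by rw [hthree]; norm_num]
  ring

lemma eventually_unimodalCount_mul_lt_sq (m : ℤ) : ∀ᶠ n in atTop,
    unimodalCount (m - 1) n * unimodalCount (m + 1) n < unimodalCount m n ^ 2 := by
  have hlim : (0 : ℝ) < 1 / 16 := by norm_num
  filter_upwards [(tendsto_unimodalCount_sq_sub_div m).eventually_const_lt hlim,
    eventually_ne_atTop 0] with n hpos hn
  have hscale := mul_pos (pow_pos (partitionScale_pos hn) 2) (saddle_pos hn)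
  rw [lt_div_iff₀ hscale, zero_mul, sub_pos] at hpos
  exact_mod_cast hpos

theorem theorem1p5_general (m : ℤ) :
    Asymptotics.IsEquivalent atTop (fun n ↦ (unimodalCount m n : ℝ))
      (fun n : ℕ ↦ 1 / (16 * √3 * n) * Real.exp (π * √(2 * n / 3))) ∧
    Asymptotics.IsEquivalent atTop
      (fun n ↦ (unimodalCount m n : ℝ) - unimodalCount (m + 1) n)
      (fun n : ℕ ↦ π * (2 * m + 1) / (96 * √2 * n ^ (3 / 2 : ℝ)) *
        Real.exp (π * √(2 * n / 3))) ∧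
    Asymptotics.IsEquivalent atTop
      (fun n ↦ (unimodalCount m n : ℝ) ^ 2 - unimodalCount (m - 1) n * unimodalCount (m + 1) n)
      (fun n : ℕ ↦ π / (768 * √6 * n ^ (5 / 2 : ℝ)) * Real.exp (2 * π * √(2 * n / 3))) ∧
    ∀ᶠ n in atTop, unimodalCount (m - 1) n * unimodalCount (m + 1) n < unimodalCount m n ^ 2 := by
  have hodd : ((2 * m + 1 : ℤ) : ℝ) ≠ 0 := Int.cast_ne_zero.mpr (by omega)
  push_cast at hodd
  simp only [← const_mul_partitionScale, ← const_mul_partitionScale_mul_saddle,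
    ← const_mul_partitionScale_sq_mul_saddle]
  exact ⟨isEquivalent_const_mul_of_tendsto_div (by norm_num) (tendsto_unimodalCount_div m),
    isEquivalent_const_mul_of_tendsto_div (div_ne_zero hodd (by norm_num))
      (tendsto_unimodalCount_sub_div m),
    isEquivalent_const_mul_of_tendsto_div (by norm_num) (tendsto_unimodalCount_sq_sub_div m),
    eventually_unimodalCount_mul_lt_sq m⟩

end

theorem theorem1p5 :
    (∀ m : ℕ,
      Asymptotics.IsEquivalent Filter.atTop
        (fun n : ℕ => (unimodalCount m n : ℝ))
        (fun n : ℕ => 1 / (16 * √3 * (n : ℝ)) * Real.exp (Real.pi * √(2 * (n : ℝ) / 3))) ∧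
      Asymptotics.IsEquivalent Filter.atTop
        (fun n : ℕ => (unimodalCount m n : ℝ) - (unimodalCount (m + 1) n : ℝ))
        (fun n : ℕ => Real.pi * (2 * (m : ℝ) + 1) / (96 * √2 * (n : ℝ) ^ (3 / 2 : ℝ)) *
          Real.exp (Real.pi * √(2 * (n : ℝ) / 3))) ∧
      Asymptotics.IsEquivalent Filter.atTop
        (fun n : ℕ => (unimodalCount m n : ℝ) ^ 2 -
          (unimodalCount (m - 1) n : ℝ) * (unimodalCount (m + 1) n : ℝ))
        (fun n : ℕ => Real.pi / (768 * √6 * (n : ℝ) ^ (5 / 2 : ℝ)) *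
          Real.exp (2 * Real.pi * √(2 * (n : ℝ) / 3)))) ∧
    (∀ m : ℤ, ∃ N : ℕ, ∀ n : ℕ, N ≤ n →
      unimodalCount (m - 1) n * unimodalCount (m + 1) n < unimodalCount m n ^ 2) := by
  refine ⟨fun m ↦ ?_, fun m ↦ Filter.eventually_atTop.mp (theorem1p5_general m).2.2.2⟩
  obtain ⟨hcount, hdiff, hsq, -⟩ := theorem1p5_general m
  exact ⟨hcount, by simpa only [Int.cast_natCast] using hdiff, hsq⟩
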